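/- Let $A\in\mathbb R^{n\times n}$, $B\in\mathbb R^{n\times m}$ with $(A,B)$ controllable (Kalman rank condition), let $Q=Q^\top\succeq 0$, $R=R^\top\succ 0$, let $x_0^1,\dots,x_0^n\in\mathbb R^n$ be linearly independent, ${\bf\Sigma}=\sum_j x_0^j(x_0^j)^\top$, and let $\gamma>0$. Put $A_K=A-BK$ and $\mathcal S=\{K\in\mathbb R^{m\times n}:\rho(A_K)<1\}$. For $K\in\mathcal S$ let $$f(K)=\sum_{j=1}^n\sum_{k=0}^\infty\Big[\langle A_K^kx_0^j,\,QA_K^kx_0^j\rangle+\langle KA_K^kx_0^j,\,RKA_K^kx_0^j\rangle\Big],$$ and let $X=X(K)$, $Y=Y(K)$ be the solutions of $A_K^\top XA_K+K^\top RK+Q=X$ and $A_KYA_K^\top+{\bf\Sigma}=Y$. A matrix $K_*\in\mathcal S$ is called optimal if $f(K_*)\le f(K)$ for all $K\in\mathcal S$. Then: 1. If $Q\succ0$, there is exactly one optimal $K_*$. 2. $\mathcal S$ is open, $\langle E,F\rangle_{Y(K)^\gamma}=\operatorname{Tr}(E^\top F\,Y(K)^\gamma)$ is a smooth Riemannian metric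 on $\mathcal S$ (tangent spaces being identified with $\mathbb R^{m\times n}$), and the gradient of $f$ for this metric at $K\in\mathcal S$ is $2(RK-B^\top X(K)A_K)Y(K)^{1-\gamma}$. Suppose now that an optimal $K_*$ exists (which is so, by 1, if $Q\succ0$), and consider the natural gradient flow $$\dot K_t=-2\big(RK_t-B^\top X(K_t)A_{K_t}\big)Y(K_t)^{1-\gamma}.$$ 3. For every $K_0\in\mathcal S$ the flow has exactly one solution $(K_t)_{t\ge0}$ in $\mathcal S$ starting at $K_0$. 4. For every $a\in\mathbb R$ there are constants $r,\alpha,c>0$ (depending only on $A,B,Q,R,x_0^1,\dots,x_0^n,\gamma,a$) such that for every $K_0\in\mathcal S$ with $f(K_0)\le a$ and all $t\ge0$, $$f(K_t)-f(K_*)\le e^{-rt}\,\big(f(K_0)-f(K_*)\big),\qquad \|K_t-K_*\|_F^2\le c\,e^{-\alpha t}\,\|K_0-K_*\|_F^2 .$$ In particular (taking $a=f(K_0)$) both quantities decay exponentially along every trajectory in $\mathcal S$. 5. $K_*$ is exponentially stable in the sense of Lyapunov: there are $\delta,\alpha,c>0$ such that every $K_0$ with $\|K_0-K_*\|_F<\delta$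 lies in $\mathcal S$ and $\|K_t-K_*\|_F^2\le c\,e^{-\alpha t}\|K_0-K_*\|_F^2$ for all $t\ge0$. -/

import Mathlib

open scoped ContDiff

/- Matrices carry the Frobenius norm. -/
attribute [local instance] Matrix.frobeniusNormedAddCommGroup Matrix.frobeniusNormedSpace

noncomputable section

namespace LQR

variable {n m : ℕ}

/-- Kalman rank condition: `rank [B, AB, …, A^(n-1) B] = n`. -/
def Controllable (A : Matrix (Fin n) (Fin n) ℝ) (B : Matrix (Fin n) (Fin m) ℝ) : Prop :=
  (Matrix.of fun (i : Fin n) (p : Fin n × Fin m) => (A ^ (p.1 : ℕ) * B) i p.2).rank = n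

/-- The closed-loop matrix `A_K = A - B K`. -/
def closedLoop (A : Matrix (Fin n) (Fin n) ℝ) (B : Matrix (Fin n) (Fin m) ℝ)
    (K : Matrix (Fin m) (Fin n) ℝ) : Matrix (Fin n) (Fin n) ℝ :=
  A - B * K

/-- The set of Schur stabilizing gains: all complex eigenvalues of `A - B K` have modulus
less than one. -/
def stabilizing (A : Matrix (Fin n) (Fin n) ℝ) (B : Matrix (Fin n) (Fin m) ℝ) :
    Set (Matrix (Fin m) (Fin n) ℝ) :=
  {K | spectralRadius ℂ ((closedLoop A B K).map (algebraMap ℝ ℂ)) < 1}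

/-- The cost `J_x(K)` of the feedback `u_k = -K x_k` from the initial state `x`, where
`x_k = (A - B K)^k x`.  The series converges for stabilizing `K`. -/
def stateCost (A : Matrix (Fin n) (Fin n) ℝ) (B : Matrix (Fin n) (Fin m) ℝ)
    (Q : Matrix (Fin n) (Fin n) ℝ) (R : Matrix (Fin m) (Fin m) ℝ)
    (x : Fin n → ℝ) (K : Matrix (Fin m) (Fin n) ℝ) : ℝ :=
  ∑' k : ℕ,
    let xk : Fin n → ℝ := (closedLoop A B K ^ k).mulVec x
    let uk : Fin m → ℝ := -(K.mulVec xk)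
    dotProduct xk (Q.mulVec xk) + dotProduct uk (R.mulVec uk)

/-- The LQR cost `f(K) = ∑ⱼ J_{xⱼ}(K)` (considered on stabilizing gains only). -/
def cost (A : Matrix (Fin n) (Fin n) ℝ) (B : Matrix (Fin n) (Fin m) ℝ)
    (Q : Matrix (Fin n) (Fin n) ℝ) (R : Matrix (Fin m) (Fin m) ℝ)
    (x₀ : Fin n → Fin n → ℝ) (K : Matrix (Fin m) (Fin n) ℝ) : ℝ :=
  ∑ j, stateCost A B Q R (x₀ j) K

/-- `K` minimizes the LQR cost over the set of stabilizing gains. -/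
def IsOptimal (A : Matrix (Fin n) (Fin n) ℝ) (B : Matrix (Fin n) (Fin m) ℝ)
    (Q : Matrix (Fin n) (Fin n) ℝ) (R : Matrix (Fin m) (Fin m) ℝ)
    (x₀ : Fin n → Fin n → ℝ) (K : Matrix (Fin m) (Fin n) ℝ) : Prop :=
  K ∈ stabilizing A B ∧ ∀ L ∈ stabilizing A B, cost A B Q R x₀ K ≤ cost A B Q R x₀ L

/-- `Σ = ∑ⱼ xⱼ xⱼᵀ`. -/
def initCov (x₀ : Fin n → Fin n → ℝ) : Matrix (Fin n) (Fin n) ℝ :=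
  ∑ j, Matrix.vecMulVec (x₀ j) (x₀ j)

/-- The solution `Z` of the Lyapunov equation `Fᵀ Z F + W = Z` (it exists and is unique if
the spectral radius of `F` is less than one). -/
def lyapunovSol (F W : Matrix (Fin n) (Fin n) ℝ) : Matrix (Fin n) (Fin n) ℝ :=
  Classical.epsilon fun Z => F.transpose * Z * F + W = Z

/-- The value matrix `X(K)`, solving `A_Kᵀ X A_K + Kᵀ R K + Q = X`. -/
def valueMatrix (A : Matrix (Fin n) (Fin n) ℝ) (B : Matrix (Fin n) (Fin m) ℝ)
    (Q : Matrix (Fin n) (Fin n) ℝ) (R : Matrix (Fin m) (Fin m) ℝ)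
    (K : Matrix (Fin m) (Fin n) ℝ) : Matrix (Fin n) (Fin n) ℝ :=
  lyapunovSol (closedLoop A B K) (K.transpose * R * K + Q)

/-- The matrix `Y(K)`, solving `A_K Y A_Kᵀ + Σ = Y`. -/
def covMatrix (A : Matrix (Fin n) (Fin n) ℝ) (B : Matrix (Fin n) (Fin m) ℝ)
    (x₀ : Fin n → Fin n → ℝ) (K : Matrix (Fin m) (Fin n) ℝ) : Matrix (Fin n) (Fin n) ℝ :=
  lyapunovSol (closedLoop A B K).transpose (initCov x₀)

/-- The real power `Y ^ s` of a symmetric positive definite matrix, by functional calculus. -/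
def matPow (Y : Matrix (Fin n) (Fin n) ℝ) (s : ℝ) : Matrix (Fin n) (Fin n) ℝ :=
  cfc (fun x : ℝ => x ^ s) Y

/-- `⟨E, F⟩_{Y(K)^γ} = Tr (Eᵀ F Y(K)^γ)`. -/
def metric (A : Matrix (Fin n) (Fin n) ℝ) (B : Matrix (Fin n) (Fin m) ℝ)
    (x₀ : Fin n → Fin n → ℝ) (γ : ℝ) (K E F : Matrix (Fin m) (Fin n) ℝ) : ℝ :=
  (E.transpose * F * matPow (covMatrix A B x₀ K) γ).trace

/-- `g` is a (smooth) Riemannian metric on the open set `U` of matrices, all tangent spaces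
being identified with the space of matrices: a bilinear, symmetric, positive definite form at
each point of `U`, depending smoothly on the point. -/
structure IsRiemannianMetricOn
    (g : Matrix (Fin m) (Fin n) ℝ → Matrix (Fin m) (Fin n) ℝ → Matrix (Fin m) (Fin n) ℝ → ℝ)
    (U : Set (Matrix (Fin m) (Fin n) ℝ)) : Prop where
  isOpen : IsOpen U
  add_left : ∀ K ∈ U, ∀ E E' F, g K (E + E') F = g K E F + g K E' F
  smul_left : ∀ K ∈ U, ∀ (c : ℝ) (E F), g K (c • E) F = c * g K E F
  symm : ∀ K ∈ U, ∀ E F, g K E F = g K F E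
  pos : ∀ K ∈ U, ∀ E, E ≠ 0 → 0 < g K E E
  smooth : ∀ E F, ContDiffOn ℝ ∞ (fun K => g K E F) U

/-- `G` is the gradient at `K` of the function `φ` for the metric `g`:
`φ` is differentiable at `K` and `dφ(K)[E] = g_K(G, E)` for all `E`. -/
def IsGradientAt
    (g : Matrix (Fin m) (Fin n) ℝ → Matrix (Fin m) (Fin n) ℝ → Matrix (Fin m) (Fin n) ℝ → ℝ)
    (φ : Matrix (Fin m) (Fin n) ℝ → ℝ) (G K : Matrix (Fin m) (Fin n) ℝ) : Prop :=
  ∃ φ' : Matrix (Fin m) (Fin n) ℝ →L[ℝ] ℝ, HasFDerivAt φ φ' K ∧ ∀ E, φ' E = g K G E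

/-- `2 (R K - Bᵀ X(K) A_K) Y(K)^(1-γ)`. -/
def natGrad (A : Matrix (Fin n) (Fin n) ℝ) (B : Matrix (Fin n) (Fin m) ℝ)
    (Q : Matrix (Fin n) (Fin n) ℝ) (R : Matrix (Fin m) (Fin m) ℝ)
    (x₀ : Fin n → Fin n → ℝ) (γ : ℝ) (K : Matrix (Fin m) (Fin n) ℝ) :
    Matrix (Fin m) (Fin n) ℝ :=
  (2 : ℝ) • ((R * K - B.transpose * valueMatrix A B Q R K * closedLoop A B K) *
    matPow (covMatrix A B x₀ K) (1 - γ))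

/-- `K` is a solution on `[0, ∞)`, with values in the stabilizing gains, of the natural gradient
flow `K̇ = -2 (R K - Bᵀ X A_K) Y^(1-γ)` with `K(0) = K₀` (one-sided derivative at `0`). -/
structure IsNatGradFlow (A : Matrix (Fin n) (Fin n) ℝ) (B : Matrix (Fin n) (Fin m) ℝ)
    (Q : Matrix (Fin n) (Fin n) ℝ) (R : Matrix (Fin m) (Fin m) ℝ)
    (x₀ : Fin n → Fin n → ℝ) (γ : ℝ) (K₀ : Matrix (Fin m) (Fin n) ℝ)
    (K : ℝ → Matrix (Fin m) (Fin n) ℝ) : Prop where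
  initial : K 0 = K₀
  mem : ∀ t, 0 ≤ t → K t ∈ stabilizing A B
  deriv : ∀ t, 0 ≤ t →
    HasDerivWithinAt K (-natGrad A B Q R x₀ γ (K t)) (Set.Ici 0) t

end LQR

end

/-! Write `D = L - K`, `G = R K - Bᵀ X(K) A_K` and `M = R + Bᵀ X(K) B`. Everything rests on an exact
identity, `cost_sub_cost`: `f(L) - f(K) = Tr ((Dᵀ M D + Dᵀ G + Gᵀ D) Y(L))`. It holds because the
Lyapunov equations for `X` and `Y` are adjoint to each other and `X(K)` satisfies the Bellman
equation of `K` up to the quadratic polynomial in `D` displayed here.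

The terms linear in `D` give `df(K)[D] = 2 Tr (Gᵀ D Y(K))`, hence the gradient. At an optimum `G =
0`, so `f(K) - f(K_*)` is a positive definite quadratic form in `K - K_*` with weight `Y(K)`: this
yields uniqueness and two-sided comparison with `‖K - K_*‖²`. Applied from `K` to `K_*` and
minimized over `D`, the identity bounds `f(K) - f(K_*)` by a multiple of `‖G‖²` (a
Polyak–Łojasiewicz inequality). Along the flow `f` decreases at rate `4 Tr (Gᵀ G Y^(2-γ))`, so
exponential decay follows by Grönwall.

The constants need `Y` bounded on sublevel sets of `f`. This is immediate for `Q ≻ 0`; for `Q ⪰ 0`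
it comes from an optimal gain, whose Lyapunov function controls nearby closed loops
(`IsOptimal.exists_trace_covMatrix_le`). The same bound makes a fixed power of `A_K` uniformly
contractive, so sublevel sets are compact inside the stabilizing set. Compactness gives existence of
the optimum, once controllability supplies a stabilizing gain, and global existence of the flow. -/

noncomputable section

namespace LQR

/-! ### Trace and Loewner-order inequalities -/

section MatrixInequalities

open scoped MatrixOrder
open Matrix

variable {ι κ : Type*} [Fintype ι] [Fintype κ]

theorem trace_mul_nonneg [DecidableEq ι] {P Z : Matrix ι ι ℝ} (hP : 0 ≤ P) (hZ : 0 ≤ Z) :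
    0 ≤ (P * Z).trace := by
  obtain ⟨S, rfl⟩ := CStarAlgebra.nonneg_iff_eq_star_mul_self.mp hZ
  rw [← mul_assoc, trace_mul_comm, ← mul_assoc]
  exact (hP.posSemidef.mul_mul_conjTranspose_same S).trace_nonneg

theorem trace_mul_le_trace_mul_right [DecidableEq ι] {P P' Z : Matrix ι ι ℝ} (h : P ≤ P')
    (hZ : 0 ≤ Z) : (P * Z).trace ≤ (P' * Z).trace := by
  have := trace_mul_nonneg (sub_nonneg.mpr h) hZ
  rw [sub_mul, trace_sub] at this
  linarith

theorem trace_mul_le_trace_mul_left [DecidableEq ι] {P P' Z : Matrix ι ι ℝ} (h : P ≤ P')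
    (hZ : 0 ≤ Z) : (Z * P).trace ≤ (Z * P').trace := by
  simpa only [trace_mul_comm Z] using trace_mul_le_trace_mul_right h hZ

theorem transpose_mul_self_nonneg (D : Matrix κ ι ℝ) : 0 ≤ Dᵀ * D := by
  rw [← conjTranspose_eq_transpose_of_trivial]
  exact (posSemidef_conjTranspose_mul_self D).nonneg

theorem transpose_mul_mul_nonneg {P : Matrix κ κ ℝ} (hP : 0 ≤ P) (D : Matrix κ ι ℝ) :
    0 ≤ Dᵀ * P * D := by
  rw [← conjTranspose_eq_transpose_of_trivial]
  exact (hP.posSemidef.conjTranspose_mul_mul_same D).nonneg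

theorem mul_mul_transpose_nonneg {P : Matrix κ κ ℝ} (hP : 0 ≤ P) (D : Matrix ι κ ℝ) :
    0 ≤ D * P * Dᵀ := by
  rw [← conjTranspose_eq_transpose_of_trivial]
  exact (hP.posSemidef.mul_mul_conjTranspose_same D).nonneg

omit [Fintype ι] in
theorem transpose_eq_of_nonneg {P : Matrix ι ι ℝ} (hP : 0 ≤ P) : Pᵀ = P := by
  have := hP.posSemidef.isHermitian.eq
  rwa [conjTranspose_eq_transpose_of_trivial] at this

theorem nonneg_of_dotProduct_nonneg {P : Matrix ι ι ℝ} (hs : Pᵀ = P)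
    (h : ∀ x : ι → ℝ, 0 ≤ x ⬝ᵥ P *ᵥ x) : 0 ≤ P := by
  refine (PosSemidef.of_dotProduct_mulVec_nonneg ?_ fun x => by simpa using h x).nonneg
  rw [IsHermitian, conjTranspose_eq_transpose_of_trivial, hs]

theorem exists_pos_smul_one_le [DecidableEq ι] {P : Matrix ι ι ℝ} (hP : P.PosDef) :
    ∃ σ > (0 : ℝ), σ • (1 : Matrix ι ι ℝ) ≤ P := by
  obtain h | h := isEmpty_or_nonempty ι
  · exact ⟨1, one_pos, (Subsingleton.elim _ _ : _ = P).le⟩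
  obtain ⟨i, hi⟩ := Finite.exists_min hP.1.eigenvalues
  refine ⟨hP.1.eigenvalues i, hP.eigenvalues_pos i, ?_⟩
  rw [← Algebra.algebraMap_eq_smul_one]
  refine (algebraMap_le_iff_le_spectrum (a := P) hP.1.isSelfAdjoint).2 fun x hx => ?_
  obtain ⟨j, rfl⟩ := hP.1.spectrum_real_eq_range_eigenvalues ▸ hx
  exact hi j

theorem le_trace_smul_one [DecidableEq ι] {P : Matrix ι ι ℝ} (hP : 0 ≤ P) :
    P ≤ P.trace • (1 : Matrix ι ι ℝ) := by
  have hP' := hP.posSemidef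
  rw [← Algebra.algebraMap_eq_smul_one]
  refine (le_algebraMap_iff_spectrum_le (a := P) hP'.1.isSelfAdjoint).2 fun x hx => ?_
  obtain ⟨j, rfl⟩ := hP'.1.spectrum_real_eq_range_eigenvalues ▸ hx
  rw [hP'.1.trace_eq_sum_eigenvalues]
  exact Finset.single_le_sum (f := hP'.1.eigenvalues) (fun i _ => hP'.eigenvalues_nonneg i)
    (Finset.mem_univ j)

theorem frobenius_norm_sq (M : Matrix κ ι ℝ) : ‖M‖ ^ 2 = (Mᵀ * M).trace := by
  rw [frobenius_norm_def, ← Real.sqrt_eq_rpow, Real.sq_sqrt (by positivity), Finset.sum_comm]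
  simp [trace, mul_apply, sq]

theorem mul_norm_sq_le_trace [DecidableEq ι] {σ : ℝ} {Y : Matrix ι ι ℝ} (hY : σ • 1 ≤ Y)
    (M : Matrix κ ι ℝ) : σ * ‖M‖ ^ 2 ≤ (Mᵀ * M * Y).trace := by
  refine le_trans (le_of_eq ?_) (trace_mul_le_trace_mul_left hY (transpose_mul_self_nonneg M))
  simp [frobenius_norm_sq]

theorem trace_le_mul_norm_sq [DecidableEq ι] {σ : ℝ} {Y : Matrix ι ι ℝ} (hY : Y ≤ σ • 1)
    (M : Matrix κ ι ℝ) : (Mᵀ * M * Y).trace ≤ σ * ‖M‖ ^ 2 := by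
  refine (trace_mul_le_trace_mul_left hY (transpose_mul_self_nonneg M)).trans (le_of_eq ?_)
  simp [frobenius_norm_sq]

theorem smul_transpose_mul_self_le [DecidableEq κ] {c : ℝ} {P : Matrix κ κ ℝ} (hP : c • 1 ≤ P)
    (D : Matrix κ ι ℝ) : c • (Dᵀ * D) ≤ Dᵀ * P * D := by
  have e : Dᵀ * P * D - c • (Dᵀ * D) = Dᵀ * (P - c • 1) * D := by
    simp [Matrix.mul_sub, Matrix.sub_mul]
  rw [← sub_nonneg, e]
  exact transpose_mul_mul_nonneg (sub_nonneg.mpr hP) D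

theorem transpose_mul_mul_le_smul [DecidableEq κ] {c : ℝ} {P : Matrix κ κ ℝ} (hP : P ≤ c • 1)
    (D : Matrix κ ι ℝ) : Dᵀ * P * D ≤ c • (Dᵀ * D) := by
  have e : c • (Dᵀ * D) - Dᵀ * P * D = Dᵀ * (c • 1 - P) * D := by
    simp [Matrix.mul_sub, Matrix.sub_mul]
  rw [← sub_nonneg, e]
  exact transpose_mul_mul_nonneg (sub_nonneg.mpr hP) D

omit [Fintype ι] in
theorem posDef_of_smul_one_le [DecidableEq ι] {σ : ℝ} (hσ : 0 < σ) {Y : Matrix ι ι ℝ}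
    (hY : σ • 1 ≤ Y) : Y.PosDef := by
  have h : (σ • (1 : Matrix ι ι ℝ)).PosDef := PosDef.one.smul hσ
  simpa using h.add_posSemidef (sub_nonneg.mpr hY).posSemidef

omit [Fintype ι] in
theorem smul_one_le_smul_one [DecidableEq ι] {c d : ℝ} (h : c ≤ d) :
    c • (1 : Matrix ι ι ℝ) ≤ d • 1 := by
  rw [← sub_nonneg, ← sub_smul]
  exact (PosSemidef.one.smul (sub_nonneg.mpr h)).nonneg

end MatrixInequalities

/-! ### Real powers of positive definite matrices -/

section MatrixPower

open scoped MatrixOrder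
open Matrix

variable {n : ℕ}

theorem spectrum_pos {Y : Matrix (Fin n) (Fin n) ℝ} (hY : Y.PosDef) {x : ℝ}
    (hx : x ∈ spectrum ℝ Y) : 0 < x := by
  obtain ⟨j, rfl⟩ := hY.1.spectrum_real_eq_range_eigenvalues ▸ hx
  exact hY.eigenvalues_pos j

theorem continuousOn_rpow_spectrum {Y : Matrix (Fin n) (Fin n) ℝ} (hY : Y.PosDef) (s : ℝ) :
    ContinuousOn (fun x : ℝ => x ^ s) (spectrum ℝ Y) := fun _ hx =>
  (Real.continuousAt_rpow_const _ _ (Or.inl (spectrum_pos hY hx).ne')).continuousWithinAt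

/-- The exponent may have either sign (it will be `2 - γ`), and the power function is monotone or
antitone accordingly; the minimum covers both cases. -/
theorem smul_one_le_matPow {Y : Matrix (Fin n) (Fin n) ℝ} {σ C : ℝ} (hσ : 0 < σ) (h₁ : σ • 1 ≤ Y)
    (h₂ : Y ≤ C • 1) (s : ℝ) : min (σ ^ s) (C ^ s) • 1 ≤ matPow Y s := by
  have hY := posDef_of_smul_one_le hσ h₁
  rw [← Algebra.algebraMap_eq_smul_one] at h₁ h₂ ⊢
  rw [algebraMap_le_iff_le_spectrum (a := Y) hY.1.isSelfAdjoint] at h₁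
  rw [le_algebraMap_iff_spectrum_le (a := Y) hY.1.isSelfAdjoint] at h₂
  refine algebraMap_le_cfc _ _ _ (fun x hx => ?_) (continuousOn_rpow_spectrum hY s)
    hY.1.isSelfAdjoint
  have hx0 := spectrum_pos hY hx
  obtain hs | hs := le_total 0 s
  · exact (min_le_left _ _).trans (Real.rpow_le_rpow hσ.le (h₁ x hx) hs)
  · exact (min_le_right _ _).trans (Real.rpow_le_rpow_of_nonpos hx0 (h₂ x hx) hs)

theorem matPow_posDef {Y : Matrix (Fin n) (Fin n) ℝ} (hY : Y.PosDef) (s : ℝ) :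
    (matPow Y s).PosDef := by
  obtain ⟨σ, hσ, h⟩ := exists_pos_smul_one_le hY
  have h2 : Y ≤ (max σ Y.trace : ℝ) • 1 :=
    (le_trace_smul_one hY.posSemidef.nonneg).trans (smul_one_le_smul_one (le_max_right _ _))
  have h0 : 0 < max σ Y.trace := hσ.trans_le (le_max_left _ _)
  exact posDef_of_smul_one_le (lt_min (Real.rpow_pos_of_pos hσ s) (Real.rpow_pos_of_pos h0 s))
    (smul_one_le_matPow hσ h h2 s)

theorem matPow_mul_matPow {Y : Matrix (Fin n) (Fin n) ℝ} (hY : Y.PosDef) (s t : ℝ) :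
    matPow Y s * matPow Y t = matPow Y (s + t) := by
  rw [matPow, matPow, ← cfc_mul _ _ Y (continuousOn_rpow_spectrum hY s)
    (continuousOn_rpow_spectrum hY t)]
  exact cfc_congr fun x hx => (Real.rpow_add (spectrum_pos hY hx) s t).symm

theorem matPow_one {Y : Matrix (Fin n) (Fin n) ℝ} (hY : Y.PosDef) : matPow Y 1 = Y := by
  simp only [matPow, Real.rpow_one]
  exact cfc_id' ℝ Y hY.1.isSelfAdjoint

theorem matPow_transpose {Y : Matrix (Fin n) (Fin n) ℝ} (hY : Y.PosDef) (s : ℝ) :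
    (matPow Y s)ᵀ = matPow Y s :=
  transpose_eq_of_nonneg (matPow_posDef hY s).posSemidef.nonneg

end MatrixPower

/-! ### Schur stability through norms of powers -/

section Schur

open Matrix Filter Topology
open scoped NNReal ENNReal

attribute [local instance] Matrix.frobeniusNormedRing Matrix.frobeniusNormedAlgebra

variable {ι : Type*} [Fintype ι] [DecidableEq ι]

/-- All complex eigenvalues of the real matrix `F` have modulus less than one. -/
def IsSchur (F : Matrix ι ι ℝ) : Prop :=
  spectralRadius ℂ (F.map (algebraMap ℝ ℂ)) < 1

theorem norm_map_pow (F : Matrix ι ι ℝ) (k : ℕ) :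
    ‖(F.map (algebraMap ℝ ℂ)) ^ k‖ = ‖F ^ k‖ := by
  have h : (F.map (algebraMap ℝ ℂ)) ^ k = (F ^ k).map (algebraMap ℝ ℂ) := by
    have := map_pow (algebraMap ℝ ℂ).mapMatrix F k
    simpa using this.symm
  rw [h]
  exact frobenius_norm_map_eq _ _ fun a => by simp

/-- Spectral mapping: `ρ(F)^k ≤ ρ(F^k) ≤ ‖F^k‖`. Stability is thus witnessed by a single power,
which makes it an open condition. -/
theorem isSchur_of_norm_pow_lt_one {F : Matrix ι ι ℝ} {k : ℕ} (hk : k ≠ 0) (h : ‖F ^ k‖ < 1) :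
    IsSchur F := by
  set a := F.map (algebraMap ℝ ℂ) with ha
  -- The Frobenius norm of the identity need not be 1, so the bound of the spectral radius by the
  -- norm is read off from Gelfand's formula.
  have h1 : spectralRadius ℂ (a ^ k) ≤ ‖a ^ k‖₊ := by
    refine le_of_tendsto (spectrum.pow_nnnorm_pow_one_div_tendsto_nhds_spectralRadius (a ^ k)) ?_
    filter_upwards [eventually_gt_atTop 0] with j hj
    have hj' : (j : ℝ) ≠ 0 := by positivity
    calc (‖(a ^ k) ^ j‖₊ : ℝ≥0∞) ^ (1 / j : ℝ) ≤ ((‖a ^ k‖₊ : ℝ≥0∞) ^ j) ^ (1 / j : ℝ) := by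
          gcongr
          exact_mod_cast nnnorm_pow_le' (a ^ k) hj
      _ = ‖a ^ k‖₊ := by
          rw [← ENNReal.rpow_natCast, ← ENNReal.rpow_mul, mul_one_div_cancel hj', ENNReal.rpow_one]
  have h2 : (‖a ^ k‖₊ : ℝ≥0∞) < 1 := by
    rw [← norm_map_pow] at h
    exact_mod_cast h
  have h3 := ((spectrum.spectralRadius_pow_le (𝕜 := ℂ) a k hk).trans h1).trans_lt h2
  by_contra hc
  exact absurd h3 (not_lt.mpr (one_le_pow₀ (not_lt.mp hc)))

theorem IsSchur.exists_norm_pow_le {F : Matrix ι ι ℝ} (hF : IsSchur F) :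
    ∃ r : ℝ, 0 ≤ r ∧ r < 1 ∧ ∀ᶠ k : ℕ in atTop, ‖F ^ k‖ ≤ r ^ k := by
  obtain ⟨r, h1, h2⟩ := ENNReal.lt_iff_exists_nnreal_btwn.mp hF
  refine ⟨r, r.2, by exact_mod_cast h2, ?_⟩
  have := (spectrum.pow_nnnorm_pow_one_div_tendsto_nhds_spectralRadius
    (F.map (algebraMap ℝ ℂ))).eventually_lt_const h1
  filter_upwards [this, eventually_gt_atTop 0] with k hk hk0
  have hk' : (k : ℝ) ≠ 0 := by positivity
  rw [← norm_map_pow]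
  have h3 : (‖(F.map (algebraMap ℝ ℂ)) ^ k‖₊ : ℝ≥0∞) ≤ (r : ℝ≥0∞) ^ k := by
    have := ENNReal.rpow_le_rpow hk.le (Nat.cast_nonneg (α := ℝ) k)
    rwa [← ENNReal.rpow_mul, one_div_mul_cancel hk', ENNReal.rpow_one, ENNReal.rpow_natCast]
      at this
  exact_mod_cast h3

theorem IsSchur.summable_norm_pow {F : Matrix ι ι ℝ} (hF : IsSchur F) :
    Summable fun k : ℕ => ‖F ^ k‖ := by
  obtain ⟨r, h0, h1, h⟩ := hF.exists_norm_pow_le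
  refine Summable.of_norm_bounded_eventually_nat (summable_geometric_of_lt_one h0 h1) ?_
  filter_upwards [h] with k hk
  simpa using hk

theorem isSchur_iff_exists_norm_pow_lt_one {F : Matrix ι ι ℝ} :
    IsSchur F ↔ ∃ k : ℕ, k ≠ 0 ∧ ‖F ^ k‖ < 1 := by
  refine ⟨fun h => ?_, fun ⟨k, hk, h⟩ => isSchur_of_norm_pow_lt_one hk h⟩
  have := (h.summable_norm_pow.tendsto_atTop_zero).eventually_lt_const one_pos
  obtain ⟨k, hk1, hk2⟩ := (this.and (eventually_gt_atTop 0)).exists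
  exact ⟨k, hk2.ne', hk1⟩

theorem IsSchur.transpose {F : Matrix ι ι ℝ} (hF : IsSchur F) : IsSchur Fᵀ := by
  obtain ⟨k, hk, h⟩ := isSchur_iff_exists_norm_pow_lt_one.mp hF
  refine isSchur_of_norm_pow_lt_one hk ?_
  rwa [← transpose_pow, frobenius_norm_transpose]

theorem continuous_norm_pow (k : ℕ) : Continuous fun F : Matrix ι ι ℝ => ‖F ^ k‖ :=
  (continuous_norm (E := Matrix ι ι ℝ)).comp (continuous_pow k)

theorem isOpen_isSchur : IsOpen {F : Matrix ι ι ℝ | IsSchur F} := by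
  have : {F : Matrix ι ι ℝ | IsSchur F} =
      ⋃ k : ℕ, ⋃ _ : k ≠ 0, {F : Matrix ι ι ℝ | ‖F ^ k‖ < 1} := by
    ext F
    simp [isSchur_iff_exists_norm_pow_lt_one]
  rw [this]
  exact isOpen_iUnion fun k => isOpen_iUnion fun _ =>
    isOpen_lt (continuous_norm_pow k) continuous_const

end Schur

/-! ### The Lyapunov equation and its series solution -/

section Lyapunov

open Matrix Filter Topology

attribute [local instance] Matrix.frobeniusNormedRing Matrix.frobeniusNormedAlgebra

variable {n : ℕ} {F W Z : Matrix (Fin n) (Fin n) ℝ}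

theorem lyapunov_series_eq {Z : Matrix (Fin n) (Fin n) ℝ} (h : Fᵀ * Z * F = Z) (k : ℕ) :
    (F ^ k)ᵀ * Z * F ^ k = Z := by
  induction k with
  | zero => simp
  | succ k ih =>
    rw [pow_succ', transpose_mul]
    calc (F ^ k)ᵀ * Fᵀ * Z * (F * F ^ k) = (F ^ k)ᵀ * (Fᵀ * Z * F) * F ^ k := by
          simp only [Matrix.mul_assoc]
      _ = Z := by rw [h, ih]

theorem IsSchur.tendsto_pow (hF : IsSchur F) : Tendsto (fun k => F ^ k) atTop (𝓝 0) :=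
  tendsto_zero_iff_norm_tendsto_zero.mpr hF.summable_norm_pow.tendsto_atTop_zero

/-- Iterating the homogeneous equation gives `Z = (F^k)ᵀ Z F^k`, which tends to 0. -/
theorem IsSchur.eq_zero_of_lyapunov (hF : IsSchur F) (h : Fᵀ * Z * F = Z) : Z = 0 := by
  have h1 : Tendsto (fun k => (F ^ k)ᵀ * Z * F ^ k) atTop (𝓝 ((0 : Matrix _ _ ℝ)ᵀ * Z * 0)) := by
    have h0 := hF.tendsto_pow
    have ht : Tendsto (fun k => (F ^ k)ᵀ) atTop (𝓝 (0 : Matrix _ _ ℝ)ᵀ) :=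
      ((continuous_id.matrix_transpose).tendsto _).comp h0
    exact (ht.mul_const Z).mul h0
  simp only [lyapunov_series_eq h] at h1
  simpa using tendsto_nhds_unique tendsto_const_nhds h1

theorem IsSchur.summable_lyapunov (hF : IsSchur F) (W : Matrix (Fin n) (Fin n) ℝ) :
    Summable fun k => (F ^ k)ᵀ * W * F ^ k := by
  have h1 := hF.summable_norm_pow
  have h2 := h1.tendsto_atTop_zero.eventually_lt_const one_pos
  have : Summable fun k => ‖W‖ * ‖F ^ k‖ := h1.mul_left _
  refine Summable.of_norm_bounded_eventually_nat this ?_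
  filter_upwards [h2] with k hk
  calc ‖(F ^ k)ᵀ * W * F ^ k‖ ≤ ‖(F ^ k)ᵀ‖ * ‖W‖ * ‖F ^ k‖ :=
        (norm_mul_le _ _).trans (by gcongr; exact norm_mul_le _ _)
    _ = ‖F ^ k‖ * ‖W‖ * ‖F ^ k‖ := by rw [frobenius_norm_transpose]
    _ ≤ 1 * ‖W‖ * ‖F ^ k‖ := by gcongr
    _ = ‖W‖ * ‖F ^ k‖ := by rw [one_mul]

theorem IsSchur.tsum_lyapunov (hF : IsSchur F) (W : Matrix (Fin n) (Fin n) ℝ) :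
    Fᵀ * (∑' k, (F ^ k)ᵀ * W * F ^ k) * F + W = ∑' k, (F ^ k)ᵀ * W * F ^ k := by
  have h := hF.summable_lyapunov W
  conv_rhs => rw [h.tsum_eq_zero_add]
  rw [← h.tsum_mul_left, ← (h.mul_left _).tsum_mul_right, add_comm]
  simp only [pow_zero, transpose_one, one_mul, mul_one, pow_succ, transpose_mul, mul_assoc]

theorem IsSchur.lyapunovSol_eq (hF : IsSchur F) (W : Matrix (Fin n) (Fin n) ℝ) :
    Fᵀ * lyapunovSol F W * F + W = lyapunovSol F W :=
  Classical.epsilon_spec (p := fun Z => Fᵀ * Z * F + W = Z) ⟨_, hF.tsum_lyapunov W⟩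

theorem IsSchur.eq_lyapunovSol (hF : IsSchur F) (h : Fᵀ * Z * F + W = Z) :
    Z = lyapunovSol F W := by
  rw [← sub_eq_zero]
  refine hF.eq_zero_of_lyapunov ?_
  conv_rhs => rw [← h, ← hF.lyapunovSol_eq W]
  simp [mul_sub, sub_mul]

theorem IsSchur.hasSum_lyapunov (hF : IsSchur F) (W : Matrix (Fin n) (Fin n) ℝ) :
    HasSum (fun k => (F ^ k)ᵀ * W * F ^ k) (lyapunovSol F W) :=
  hF.eq_lyapunovSol (hF.tsum_lyapunov W) ▸ (hF.summable_lyapunov W).hasSum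

theorem IsSchur.transpose_lyapunovSol (hF : IsSchur F) (hW : Wᵀ = W) :
    (lyapunovSol F W)ᵀ = lyapunovSol F W := by
  refine hF.eq_lyapunovSol ?_
  conv_rhs => rw [← hF.lyapunovSol_eq W]
  simp [hW, mul_assoc]

open scoped MatrixOrder in
theorem IsSchur.lyapunovSol_nonneg (hF : IsSchur F) (hW : 0 ≤ W) : 0 ≤ lyapunovSol F W := by
  refine nonneg_of_dotProduct_nonneg (hF.transpose_lyapunovSol (transpose_eq_of_nonneg hW))
    fun x => ?_
  have hc : Continuous fun Z : Matrix (Fin n) (Fin n) ℝ => x ⬝ᵥ Z *ᵥ x := by fun_prop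
  have hs := hF.hasSum_lyapunov W
  let φ : Matrix (Fin n) (Fin n) ℝ →+ ℝ :=
    { toFun := fun Z => x ⬝ᵥ Z *ᵥ x
      map_zero' := by simp
      map_add' := by simp [add_mulVec] }
  have h := hs.map φ hc
  refine h.nonneg fun k => ?_
  have := (transpose_mul_mul_nonneg hW (F ^ k)).posSemidef.dotProduct_mulVec_nonneg x
  simpa [φ] using this

open scoped MatrixOrder in
theorem IsSchur.le_lyapunovSol (hF : IsSchur F) (hW : 0 ≤ W) : W ≤ lyapunovSol F W := by
  conv_rhs => rw [← hF.lyapunovSol_eq W]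
  exact le_add_of_nonneg_left (transpose_mul_mul_nonneg (hF.lyapunovSol_nonneg hW) F)

end Lyapunov

/-! ### Smooth solutions of linear equations; binomial series -/

section Smoothness

open Filter Topology
open scoped NNReal ENNReal

variable {E V W 𝔸 : Type*} [NormedAddCommGroup E] [NormedSpace ℝ E]
  [NormedAddCommGroup V] [NormedSpace ℝ V] [NormedAddCommGroup W] [NormedSpace ℝ W]
  [NormedRing 𝔸] [NormedAlgebra ℝ 𝔸]

theorem contDiff_linearMap [FiniteDimensional ℝ V] (f : V →ₗ[ℝ] W) {k : ℕ∞ω} :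
    ContDiff ℝ k f :=
  (LinearMap.toContinuousLinearMap f).contDiff

/-- Solutions of a linear equation with smooth coefficients are smooth. -/
theorem contDiffAt_of_clm_apply_eq [FiniteDimensional ℝ V] {T : E → V →L[ℝ] V} {z w : E → V}
    {x : E} (hT : ContDiffAt ℝ ∞ T x) (hw : ContDiffAt ℝ ∞ w x)
    (hinj : Function.Injective (T x)) (h : ∀ᶠ y in 𝓝 x, T y (z y) = w y) :
    ContDiffAt ℝ ∞ z x := by
  have : CompleteSpace V := FiniteDimensional.complete ℝ V
  let e : V ≃L[ℝ] V :=
    (LinearEquiv.ofInjectiveEndo (T x : V →ₗ[ℝ] V) hinj).toContinuousLinearEquiv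
  have he : (e : V →L[ℝ] V) = T x := by ext1 v; rfl
  have h1 : ContDiffAt ℝ ∞ ContinuousLinearMap.inverse (T x) := he ▸ contDiffAt_map_inverse e
  have h2 : ∀ᶠ y in 𝓝 x, ∃ e' : V ≃L[ℝ] V, (e' : V →L[ℝ] V) = T y :=
    hT.continuousAt.eventually_mem
      (ContinuousLinearEquiv.isOpen.mem_nhds (s := Set.range _) ⟨e, he⟩)
  refine ((h1.comp x hT).clm_apply hw).congr_of_eventuallyEq ?_
  filter_upwards [h, h2] with y hy ⟨e', he'⟩
  rw [Function.comp_apply, ← hy, ← he', ContinuousLinearMap.inverse_equiv]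
  exact (e'.symm_apply_apply _).symm

theorem contDiffAt_of_sub_mul_mul_eq [FiniteDimensional ℝ 𝔸] {a b z w : E → 𝔸} {x : E}
    (ha : ContDiffAt ℝ ∞ a x) (hb : ContDiffAt ℝ ∞ b x) (hw : ContDiffAt ℝ ∞ w x)
    (hinj : ∀ c, a x * c * b x = c → c = 0)
    (h : ∀ᶠ y in 𝓝 x, z y - a y * z y * b y = w y) : ContDiffAt ℝ ∞ z x := by
  refine contDiffAt_of_clm_apply_eq (T := fun y => ContinuousLinearMap.id ℝ 𝔸 -
    ContinuousLinearMap.mulLeftRight ℝ 𝔸 (a y) (b y)) ?_ hw ?_ ?_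
  · refine contDiffAt_const.sub ?_
    exact ((ContinuousLinearMap.mulLeftRight ℝ 𝔸).contDiff.contDiffAt.comp x ha).clm_apply hb
  · refine (injective_iff_map_eq_zero _).2 fun c hc => hinj c ?_
    simpa [sub_eq_zero, eq_comm] using hc
  · filter_upwards [h] with y hy
    simpa using hy

/-- The coefficients are those of the scalar series, whose radius is at least 1. Degree 0 is left
out of the comparison because the unit of `𝔸` may have norm above 1. -/
theorem one_le_radius_binomialSeries (s : ℝ) : 1 ≤ (binomialSeries 𝔸 s).radius := by
  refine ENNReal.le_of_forall_nnreal_lt fun r hr => ?_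
  have hr' : (r : ℝ≥0∞) < (binomialSeries ℝ s).radius := hr.trans_le binomialSeries_radius_ge_one
  obtain ⟨C, -, hC⟩ := (binomialSeries ℝ s).norm_mul_pow_le_of_lt_radius hr'
  refine FormalMultilinearSeries.le_radius_of_eventually_le _ C ?_
  filter_upwards [eventually_gt_atTop 0] with k hk
  refine le_trans ?_ (hC k)
  have h1 := FormalMultilinearSeries.ofScalars_norm_le 𝔸 (fun j => Ring.choose s j) k hk
  have h2 := FormalMultilinearSeries.ofScalars_norm ℝ (fun j => Ring.choose s j) k
  rw [binomialSeries, binomialSeries, h2]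
  gcongr

theorem contDiffAt_binomialSeries_sum [CompleteSpace 𝔸] (s : ℝ) {x : 𝔸} (hx : ‖x‖ < 1) :
    ContDiffAt ℝ ∞ (binomialSeries 𝔸 s).sum x := by
  have h1 := one_le_radius_binomialSeries (𝔸 := 𝔸) s
  have h := (binomialSeries 𝔸 s).hasFPowerSeriesOnBall (one_pos.trans_le h1)
  refine (h.analyticAt_of_mem ?_).contDiffAt
  refine Metric.eball_subset_eball h1 ?_
  rw [Metric.mem_eball, edist_zero_right, ← ofReal_norm, ENNReal.ofReal_lt_one]
  exact hx

end Smoothness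

/-! ### Smooth dependence of Lyapunov solutions -/

section LyapunovSmooth

open Matrix Filter Topology

attribute [local instance] Matrix.frobeniusNormedRing Matrix.frobeniusNormedAlgebra

variable {n : ℕ} {E : Type*} [NormedAddCommGroup E] [NormedSpace ℝ E]

theorem contDiff_transpose {m n : ℕ} {k : ℕ∞ω} :
    ContDiff ℝ k fun F : Matrix (Fin m) (Fin n) ℝ => Fᵀ :=
  contDiff_linearMap (transposeLinearEquiv (Fin m) (Fin n) ℝ ℝ).toLinearMap

theorem contDiffAt_lyapunovSol {f w : E → Matrix (Fin n) (Fin n) ℝ} {x : E}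
    (hf : ContDiffAt ℝ ∞ f x) (hw : ContDiffAt ℝ ∞ w x) (hx : IsSchur (f x)) :
    ContDiffAt ℝ ∞ (fun y => lyapunovSol (f y) (w y)) x := by
  refine contDiffAt_of_sub_mul_mul_eq (𝔸 := Matrix (Fin n) (Fin n) ℝ)
    (contDiff_transpose.contDiffAt.comp x hf) hf hw (fun c => hx.eq_zero_of_lyapunov) ?_
  filter_upwards [hf.continuousAt.eventually_mem (isOpen_isSchur.mem_nhds hx)] with y hy
  exact sub_eq_of_eq_add' (IsSchur.lyapunovSol_eq hy (w y)).symm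

end LyapunovSmooth

/-! ### Smoothness of the matrix power -/

section MatrixPowerSmooth

open Matrix Filter Topology

variable {n : ℕ} {Y : Matrix (Fin n) (Fin n) ℝ}

theorem cfc_eq_mul_diagonal_mul (hY : Y.IsHermitian) (f : ℝ → ℝ) :
    cfc f Y = (hY.eigenvectorUnitary : Matrix (Fin n) (Fin n) ℝ) *
      diagonal (f ∘ hY.eigenvalues) * star (hY.eigenvectorUnitary : Matrix (Fin n) (Fin n) ℝ) := by
  rw [hY.cfc_eq, IsHermitian.cfc, Unitary.conjStarAlgAut_apply]
  rfl

/-- The operator norm sees only the largest eigenvalue in modulus. Convergence of the binomial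
series needs this; the Frobenius norm of `c⁻¹ Y - 1` could exceed 1. -/
theorem norm_toEuclideanCLM_cfc (hY : Y.IsHermitian) (f : ℝ → ℝ) :
    ‖toEuclideanCLM (𝕜 := ℝ) (cfc f Y)‖ = ‖f ∘ hY.eigenvalues‖ := by
  rw [cfc_eq_mul_diagonal_mul hY, map_mul, map_mul, map_star]
  obtain ⟨U, hU⟩ : ∃ U : unitary (EuclideanSpace ℝ (Fin n) →L[ℝ] EuclideanSpace ℝ (Fin n)),
      toEuclideanCLM (𝕜 := ℝ) (hY.eigenvectorUnitary : Matrix (Fin n) (Fin n) ℝ) = U :=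
    ⟨⟨_, Unitary.map_mem (toEuclideanCLM (𝕜 := ℝ) (n := Fin n)) hY.eigenvectorUnitary.2⟩, rfl⟩
  rw [hU, ← Unitary.coe_star, CStarRing.norm_mul_coe_unitary, CStarRing.norm_coe_unitary_mul]
  exact l2_opNorm_diagonal _

theorem hasSum_cfc (hY : Y.IsHermitian) {f : ℕ → ℝ → ℝ} {g : ℝ → ℝ}
    (h : ∀ i, HasSum (fun k => f k (hY.eigenvalues i)) (g (hY.eigenvalues i))) :
    HasSum (fun k => cfc (f k) Y) (cfc g Y) := by
  simp only [cfc_eq_mul_diagonal_mul hY]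
  have h1 : HasSum (fun k => diagonal (f k ∘ hY.eigenvalues)) (diagonal (g ∘ hY.eigenvalues)) :=
    HasSum.matrix_diagonal (Pi.hasSum.2 h)
  exact (h1.mul_left _).mul_right _

theorem smul_sub_one_eq_cfc (hY : Y.IsHermitian) (c : ℝ) :
    c • Y - 1 = cfc (fun x => c * x - 1) Y := by
  rw [cfc_sub _ _ Y, cfc_const_mul _ _ Y, cfc_id' ℝ Y hY.isSelfAdjoint, cfc_const_one ℝ Y]

/-- With `c` above all eigenvalues, `Y^s = c^s (1 + (c⁻¹ Y - 1))^s` is a binomial series in an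
operator of norm below 1. The series is smooth on a full neighbourhood, while the functional
calculus is meaningful only at Hermitian matrices, so agreement is asserted only there. -/
theorem exists_contDiffAt_eq_matPow (hY : Y.PosDef) (s : ℝ) :
    ∃ h : Matrix (Fin n) (Fin n) ℝ → Matrix (Fin n) (Fin n) ℝ, ContDiffAt ℝ ∞ h Y ∧
      ∀ᶠ Z in 𝓝 Y, Z.IsHermitian → matPow Z s = h Z := by
  let 𝔸 := EuclideanSpace ℝ (Fin n) →L[ℝ] EuclideanSpace ℝ (Fin n)
  let φ : Matrix (Fin n) (Fin n) ℝ ≃⋆ₐ[ℝ] 𝔸 := toEuclideanCLM (𝕜 := ℝ)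
  let φl : Matrix (Fin n) (Fin n) ℝ ≃ₗ[ℝ] 𝔸 := φ.toAlgEquiv.toLinearEquiv
  obtain ⟨c, hc, hcY⟩ : ∃ c > 0, ∀ i, hY.1.eigenvalues i ≤ c := by
    refine ⟨‖hY.1.eigenvalues‖ + 1, by positivity, fun i => ?_⟩
    have := norm_le_pi_norm hY.1.eigenvalues i
    rw [Real.norm_eq_abs] at this
    linarith [le_abs_self (hY.1.eigenvalues i)]
  have hsm : ContDiff ℝ ∞ fun Z : Matrix (Fin n) (Fin n) ℝ => φ (c⁻¹ • Z - 1) :=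
    (contDiff_linearMap φl.toLinearMap).comp ((contDiff_id.const_smul _).sub contDiff_const)
  have hnorm : ‖φ (c⁻¹ • Y - 1)‖ < 1 := by
    rw [smul_sub_one_eq_cfc hY.1, norm_toEuclideanCLM_cfc hY.1, pi_norm_lt_iff one_pos]
    intro i
    have h1 := hY.eigenvalues_pos i
    have h2 : c⁻¹ * hY.1.eigenvalues i ≤ 1 := by
      rw [inv_mul_le_iff₀ hc, mul_one]
      exact hcY i
    have h3 : 0 < c⁻¹ * hY.1.eigenvalues i := by positivity
    rw [Function.comp_apply, Real.norm_eq_abs, abs_lt]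
    constructor <;> linarith
  refine ⟨fun Z => c ^ s • φl.symm ((binomialSeries 𝔸 s).sum (φ (c⁻¹ • Z - 1))), ?_, ?_⟩
  · refine ContDiffAt.const_smul _ ?_
    refine (contDiff_linearMap φl.symm.toLinearMap).contDiffAt.comp Y ?_
    exact (contDiffAt_binomialSeries_sum s hnorm).comp Y hsm.contDiffAt
  · have hev : ∀ᶠ Z in 𝓝 Y, ‖φ (c⁻¹ • Z - 1)‖ < 1 :=
      (hsm.continuous.norm.continuousAt.eventually_lt continuousAt_const hnorm)
    filter_upwards [hev] with Z hZ hZh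
    have hZ' := hZ
    rw [smul_sub_one_eq_cfc hZh, norm_toEuclideanCLM_cfc hZh, pi_norm_lt_iff one_pos] at hZ'
    have hs : HasSum (fun k => cfc (fun x => Ring.choose s k * (c⁻¹ * x - 1) ^ k) Z)
        (cfc (fun x => (1 + (c⁻¹ * x - 1)) ^ s) Z) := by
      refine hasSum_cfc hZh fun i => ?_
      have h1 := Real.one_add_rpow_hasFPowerSeriesOnBall_zero (a := s)
      have h2 := h1.hasSum (y := c⁻¹ * hZh.eigenvalues i - 1) (by
        rw [Metric.mem_eball, edist_zero_right, ← ofReal_norm, ENNReal.ofReal_lt_one]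
        exact hZ' i)
      simpa [binomialSeries, FormalMultilinearSeries.ofScalars_apply_eq, mul_comm] using h2
    have hs2 : HasSum (fun k => φ (cfc (fun x => Ring.choose s k * (c⁻¹ * x - 1) ^ k) Z))
        (φ (cfc (fun x => (1 + (c⁻¹ * x - 1)) ^ s) Z)) :=
      hs.map (φ : Matrix (Fin n) (Fin n) ℝ →+ 𝔸)
        (contDiff_linearMap (k := ∞) φl.toLinearMap).continuous
    have hsum : (binomialSeries 𝔸 s).sum (φ (c⁻¹ • Z - 1)) =
        φ (cfc (fun x => (1 + (c⁻¹ * x - 1)) ^ s) Z) := by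
      refine Eq.trans (FormalMultilinearSeries.ofScalars_sum_eq _ _) ?_
      rw [← hs2.tsum_eq]
      refine tsum_congr fun k => ?_
      rw [cfc_const_mul _ _ Z, cfc_pow _ _ Z, ← smul_sub_one_eq_cfc hZh, map_smul, map_pow]
    have hsymm : φl.symm (φ (cfc (fun x => (1 + (c⁻¹ * x - 1)) ^ s) Z)) =
        cfc (fun x => (1 + (c⁻¹ * x - 1)) ^ s) Z := φl.symm_apply_apply _
    rw [hsum, hsymm, matPow]
    have hfin : (spectrum ℝ Z).Finite := by
      rw [hZh.spectrum_real_eq_range_eigenvalues]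
      exact Set.finite_range _
    rw [← cfc_const_mul _ _ Z (hfin.continuousOn _)]
    refine cfc_congr fun x hx => ?_
    obtain ⟨i, rfl⟩ := hZh.spectrum_real_eq_range_eigenvalues ▸ hx
    have h1 := hZ' i
    rw [Function.comp_apply, Real.norm_eq_abs, abs_lt] at h1
    have h2 : 0 ≤ c⁻¹ * hZh.eigenvalues i := by linarith
    simp only [add_sub_cancel]
    rw [← Real.mul_rpow hc.le h2, mul_inv_cancel_left₀ hc.ne']

theorem contDiffAt_matPow {E : Type*} [NormedAddCommGroup E] [NormedSpace ℝ E]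
    {f : E → Matrix (Fin n) (Fin n) ℝ} {x : E} (hf : ContDiffAt ℝ ∞ f x) (hx : (f x).PosDef)
    (h : ∀ᶠ y in 𝓝 x, (f y).IsHermitian) (s : ℝ) :
    ContDiffAt ℝ ∞ (fun y => matPow (f y) s) x := by
  obtain ⟨g, hg, hgs⟩ := exists_contDiffAt_eq_matPow hx s
  refine (hg.comp x hf).congr_of_eventuallyEq ?_
  filter_upwards [hf.continuousAt.eventually hgs, h] with y hy hy'
  exact hy hy'

end MatrixPowerSmooth

/-! ### Global solutions of descent flows -/

section GlobalFlow

open Set Filter Topology Metric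
open scoped NNReal

variable {V : Type*} [NormedAddCommGroup V] [NormedSpace ℝ V]

/-- A bounded Lipschitz vector field is complete. -/
theorem exists_forall_hasDerivAt_of_lipschitzWith [CompleteSpace V] {w : V → V} {K M : ℝ≥0}
    (hw : LipschitzWith K w) (hM : ∀ x, ‖w x‖ ≤ M) (x₀ : V) :
    ∃ x : ℝ → V, x 0 = x₀ ∧ ∀ t, HasDerivAt x (w (x t)) t := by
  have hloc : ∀ T : ℝ, ∃ x : ℝ → V, x 0 = x₀ ∧ ∀ t ∈ Ioo (-T) T, HasDerivAt x (w (x t)) t := by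
    intro T
    obtain hT | hT := le_or_gt T 0
    · exact ⟨fun _ => x₀, rfl, fun t ht => by linarith [ht.1, ht.2]⟩
    have h0 : (0 : ℝ) ∈ Icc (-T) T := ⟨by linarith, hT.le⟩
    -- In time `T` at speed at most `M` a solution travels at most `M T`, the radius chosen here.
    have hPL : IsPicardLindelof (fun _ => w) (⟨0, h0⟩ : Icc (-T) T) x₀ (M * T.toNNReal) 0 M K :=
      IsPicardLindelof.of_time_independent (fun x _ => hM x) hw.lipschitzOnWith (by
        simp [hT.le])
    obtain ⟨x, hx0, hx⟩ := hPL.exists_eq_forall_mem_Icc_hasDerivWithinAt₀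
    exact ⟨x, hx0, fun t ht => (hx t (Ioo_subset_Icc_self ht)).hasDerivAt
      (Icc_mem_nhds ht.1 ht.2)⟩
  choose x hx0 hx using hloc
  have heq : ∀ {S T : ℝ}, 0 < S → S ≤ T → EqOn (x T) (x S) (Ioo (-S) S) := fun {S T} hS hST =>
    ODE_solution_unique_of_mem_Ioo (v := fun _ => w) (s := fun _ => univ) (t₀ := 0)
      (fun _ _ => hw.lipschitzOnWith) ⟨by linarith, hS⟩
      (fun t ht => ⟨hx T t ⟨by linarith [ht.1], by linarith [ht.2]⟩, trivial⟩)
      (fun t ht => ⟨hx S t ht, trivial⟩) ((hx0 T).trans (hx0 S).symm)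
  -- Glue the local solutions: at time `t` use the one on an interval strictly containing `t`.
  refine ⟨fun t => x (|t| + 1) t, hx0 _, fun t => ?_⟩
  have ht : t ∈ Ioo (-(|t| + 1)) (|t| + 1) := abs_lt.mp (lt_add_one _)
  refine (hx (|t| + 1) t ht).congr_of_eventuallyEq ?_
  filter_upwards [Ioo_mem_nhds ht.1 ht.2] with s hs
  have hs' : s ∈ Ioo (-(|s| + 1)) (|s| + 1) := abs_lt.mp (lt_add_one _)
  obtain h | h := le_total (|s| + 1) (|t| + 1)
  · exact (heq (by positivity) h hs').symm
  · exact heq (by positivity) h hs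

variable [FiniteDimensional ℝ V]

theorem exists_lipschitzWith_eqOn {U S : Set V} (hU : IsOpen U) (hS : IsCompact S) (hSU : S ⊆ U)
    {v : V → V} (hv : ContDiffOn ℝ ∞ v U) :
    ∃ (χ : V → ℝ) (K M : ℝ≥0), (∀ x, 0 ≤ χ x) ∧ (∀ x ∈ S, χ x = 1) ∧
      LipschitzWith K (fun x => χ x • v x) ∧ ∀ x, ‖χ x • v x‖ ≤ M := by
  have : CompleteSpace V := FiniteDimensional.complete ℝ V
  have : ProperSpace V := FiniteDimensional.proper ℝ V
  obtain ⟨T, hT, hST, hTU⟩ := exists_compact_between hS hU hSU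
  obtain ⟨χ, hχ1, hχ0, hχ⟩ := exists_contMDiffMap_one_nhds_of_subset_interior (n := (⊤ : ℕ∞))
    (modelWithCornersSelf ℝ V) hS.isClosed hST
  have hsupp : tsupport (fun x => χ x • v x) ⊆ T := by
    refine closure_minimal (fun x hx => ?_) hT.isClosed
    by_contra hxT
    exact hx (by simp [hχ0 x hxT])
  have hcs : HasCompactSupport (fun x => χ x • v x) :=
    HasCompactSupport.of_support_subset_isCompact hT (subset_closure.trans hsupp)
  have hsm : ContDiff ℝ ∞ (fun x => χ x • v x) := by
    rw [contDiff_iff_contDiffAt]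
    intro x
    by_cases hx : x ∈ U
    · exact (χ.contMDiff.contDiff.contDiffAt).smul (hv.contDiffAt (hU.mem_nhds hx))
    · have h0 : (fun x => χ x • v x) =ᶠ[𝓝 x] fun _ => 0 := by
        filter_upwards [hT.isClosed.isOpen_compl.mem_nhds fun h => hx (hTU h)] with y hy
        simp [hχ0 y hy]
      exact contDiffAt_const.congr_of_eventuallyEq h0
  obtain ⟨K, hK⟩ := ContDiff.lipschitzWith_of_hasCompactSupport hcs hsm (by simp)
  obtain ⟨M, hM⟩ := hcs.exists_bound_of_continuous hsm.continuous
  refine ⟨χ, K, M.toNNReal, fun x => (hχ x).1, fun x hx => ?_, hK, fun x => (hM x).trans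
    (Real.le_coe_toNNReal M)⟩
  exact hχ1.self_of_nhdsSet x hx

variable {U : Set V} {v : V → V} {φ : V → ℝ} {φ' : V → V →L[ℝ] ℝ}

omit [FiniteDimensional ℝ V] in
theorem antitoneOn_comp_of_hasDerivWithinAt (hφ : ∀ x ∈ U, HasFDerivAt φ (φ' x) x)
    (hdec : ∀ x ∈ U, φ' x (v x) ≤ 0) {c : V → ℝ} (hc : ∀ x, 0 ≤ c x) {I : Set ℝ} (hI : Convex ℝ I)
    {x : ℝ → V} (hx : ∀ t ∈ I, x t ∈ U) (hd : ∀ t ∈ I, HasDerivWithinAt x (c (x t) • v (x t)) I t) :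
    AntitoneOn (φ ∘ x) I := by
  have h : ∀ t ∈ I, HasDerivWithinAt (φ ∘ x) (φ' (x t) (c (x t) • v (x t))) I t := fun t ht =>
    (hφ _ (hx t ht)).comp_hasDerivWithinAt t (hd t ht)
  refine antitoneOn_of_hasDerivWithinAt_nonpos hI (fun t ht => (h t ht).continuousWithinAt)
    (fun t ht => (h t (interior_subset ht)).mono interior_subset) fun t ht => ?_
  rw [map_smul]
  exact mul_nonpos_of_nonneg_of_nonpos (hc _) (hdec _ (hx t (interior_subset ht)))

/-- A descent field for a function with compact sublevel sets in `U` has a unique forward solution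
in `U` from each point of `U`. -/
theorem exists_unique_flow (hU : IsOpen U) (hv : ContDiffOn ℝ ∞ v U)
    (hφ : ∀ x ∈ U, HasFDerivAt φ (φ' x) x) (hdec : ∀ x ∈ U, φ' x (v x) ≤ 0)
    (hcpt : ∀ a, IsCompact {x | x ∈ U ∧ φ x ≤ a}) {x₀ : V} (hx₀ : x₀ ∈ U) :
    ∃ x : ℝ → V, (x 0 = x₀ ∧ (∀ t, 0 ≤ t → x t ∈ U) ∧
        ∀ t, 0 ≤ t → HasDerivWithinAt x (v (x t)) (Ici 0) t) ∧
      ∀ y : ℝ → V, y 0 = x₀ → (∀ t, 0 ≤ t → y t ∈ U) →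
        (∀ t, 0 ≤ t → HasDerivWithinAt y (v (y t)) (Ici 0) t) → EqOn y x (Ici 0) := by
  have : CompleteSpace V := FiniteDimensional.complete ℝ V
  obtain ⟨χ, K, M, hχ0, hχ1, hK, hM⟩ :=
    exists_lipschitzWith_eqOn hU (hcpt (φ x₀)) (fun _ h => h.1) hv
  obtain ⟨x, hx0, hx⟩ := exists_forall_hasDerivAt_of_lipschitzWith hK hM x₀
  have hxc : Continuous x := continuous_iff_continuousAt.2 fun t => (hx t).continuousAt
  -- Continuous induction in time for the cut-off flow. The sublevel set is closed; openness of `U`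
  -- keeps `x` in `U` a little longer, and there descent keeps `φ` below its initial value. The
  -- factor `χ ≥ 0` does not spoil descent.
  have hmem : ∀ t, 0 ≤ t → x t ∈ {x | x ∈ U ∧ φ x ≤ φ x₀} := by
    intro T hT
    have hcl : IsClosed ({t | x t ∈ {x | x ∈ U ∧ φ x ≤ φ x₀}} ∩ Icc 0 T) :=
      ((hcpt (φ x₀)).isClosed.preimage hxc).inter isClosed_Icc
    refine hcl.Icc_subset_of_forall_exists_gt (by simp [hx0, hx₀]) (fun t ht y hy => ?_)
      ⟨hT, le_rfl⟩
    obtain ⟨ε, hε, hball⟩ := Metric.isOpen_iff.1 (hU.preimage hxc) t ht.1.1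
    have hlt : t < min y (t + ε / 2) := lt_min hy (by linarith)
    have hIU : ∀ s ∈ Icc t (min y (t + ε / 2)), x s ∈ U := fun s hs => hball (by
      have := hs.2.trans (min_le_right _ _)
      rw [Metric.mem_ball, Real.dist_eq, abs_of_nonneg (by linarith [hs.1])]
      linarith)
    have hanti := antitoneOn_comp_of_hasDerivWithinAt hφ hdec hχ0 (convex_Icc _ _) hIU
      fun s _ => (hx s).hasDerivWithinAt
    exact ⟨_, ⟨hIU _ ⟨hlt.le, le_rfl⟩, (hanti ⟨le_rfl, hlt.le⟩ ⟨hlt.le, le_rfl⟩ hlt.le).trans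
      ht.1.2⟩, hlt, min_le_left _ _⟩
  refine ⟨x, ⟨hx0, fun t ht => (hmem t ht).1, fun t ht => ?_⟩, fun y hy0 hyU hy t ht => ?_⟩
  · have := (hx t).hasDerivWithinAt (s := Ici 0)
    rwa [hχ1 _ (hmem t ht), one_smul] at this
  -- A competing solution also descends, so it stays where `χ = 1` and solves the same globally
  -- Lipschitz equation.
  · have hanti : AntitoneOn (φ ∘ y) (Ici 0) :=
      antitoneOn_comp_of_hasDerivWithinAt hφ hdec (c := fun _ => 1) (fun _ => zero_le_one)
        (convex_Ici _) hyU (fun s hs => by simpa using hy s hs)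
    have hymem : ∀ s, 0 ≤ s → χ (y s) = 1 := fun s hs =>
      hχ1 _ ⟨hyU s hs, hy0 ▸ hanti (mem_Ici.2 le_rfl) hs hs⟩
    refine ODE_solution_unique (v := fun _ x => χ x • v x) (fun _ => hK)
      (fun s hs => ((hy s hs.1).continuousWithinAt).mono Icc_subset_Ici_self)
      (fun s hs => ?_) hxc.continuousOn (fun s _ => (hx s).hasDerivWithinAt)
      (hy0.trans hx0.symm) (mem_Icc.2 ⟨ht, le_rfl⟩)
    rw [hymem s hs.1, one_smul]
    exact (hy s hs.1).mono (Ici_subset_Ici.2 hs.1)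

end GlobalFlow

/-! ### Deadbeat feedback for linear systems -/

section Deadbeat

variable {k V U : Type*} [Field k] [AddCommGroup V] [Module k V] [AddCommGroup U] [Module k U]

/-- The states of the system `x ↦ A x + B u` that can be steered to `0` in `j` steps. -/
def nullControllable (A : V →ₗ[k] V) (B : U →ₗ[k] V) : ℕ → Submodule k V
  | 0 => ⊥
  | j + 1 => (nullControllable A B j ⊔ LinearMap.range B).comap A

variable (A : V →ₗ[k] V) (B : U →ₗ[k] V)

theorem nullControllable_le_succ (j : ℕ) :
    nullControllable A B j ≤ nullControllable A B (j + 1) := by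
  induction j with
  | zero => exact bot_le
  | succ j ih => exact Submodule.comap_mono (sup_le_sup_right ih _)

/-- Modulo `N`, the vector `-A x` lies in the range of `B`; a linear section of `B` modulo `N`,
extended to the whole quotient, picks the control linearly. -/
theorem exists_forall_add_mem (N : Submodule k V) : ∃ v : V →ₗ[k] U,
    ∀ x, A x ∈ N ⊔ LinearMap.range B → A x + B (v x) ∈ N := by
  obtain ⟨r, hr⟩ := (N.mkQ ∘ₗ B).rangeRestrict.exists_rightInverse_of_surjective
    (LinearMap.range_rangeRestrict _)
  obtain ⟨g, hg⟩ := LinearMap.exists_extend r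
  refine ⟨-(g ∘ₗ N.mkQ ∘ₗ A), fun x hx => ?_⟩
  obtain ⟨p, hp, q, ⟨u, rfl⟩, hpq⟩ := Submodule.mem_sup.1 hx
  have hy : N.mkQ (A x) = N.mkQ (B u) := by
    rw [← hpq, map_add, (Submodule.Quotient.mk_eq_zero N).2 hp |> (show N.mkQ p = 0 from ·),
      zero_add]
  have h1 : g (N.mkQ (B u)) = r ⟨N.mkQ (B u), u, rfl⟩ :=
    LinearMap.congr_fun hg ⟨N.mkQ (B u), u, rfl⟩
  have h2 := congrArg Subtype.val (LinearMap.congr_fun hr ⟨N.mkQ (B u), u, rfl⟩)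
  rw [← Submodule.Quotient.mk_eq_zero N]
  change N.mkQ (A x + B (-g (N.mkQ (A x)))) = 0
  rw [hy, h1, map_neg, map_add, map_neg, hy, ← sub_eq_add_neg, sub_eq_zero]
  exact h2.symm

theorem exists_feedback_nullControllable (j : ℕ) : ∃ f : V →ₗ[k] U, ∀ i < j,
    ∀ x ∈ nullControllable A B (i + 1), A x + B (f x) ∈ nullControllable A B i := by
  induction j with
  | zero => exact ⟨0, fun i hi => absurd hi (Nat.not_lt_zero i)⟩
  | succ j ih =>
    obtain ⟨f, hf⟩ := ih
    obtain ⟨v, hv⟩ := exists_forall_add_mem A B (nullControllable A B j)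
    obtain ⟨p, hp⟩ := LinearMap.exists_extend (LinearMap.id (R := k) (M := nullControllable A B j))
    have hp' : ∀ x ∈ nullControllable A B j, (p x : V) = x := fun x hx =>
      congrArg Subtype.val (LinearMap.congr_fun hp ⟨x, hx⟩)
    let P : V →ₗ[k] V := (nullControllable A B j).subtype ∘ₗ p
    have hPmem : ∀ x, P x ∈ nullControllable A B j := fun x => (p x).2
    -- Keep the old feedback on the states already handled, through the projection `P` onto them,
    -- and use `v` on the complement to gain one more step.
    refine ⟨(f ∘ₗ P + v ∘ₗ (LinearMap.id - P) : V →ₗ[k] U), fun i hi x hx => ?_⟩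
    change A x + B (f (P x) + v (x - P x)) ∈ _
    obtain hi' | rfl := Nat.lt_succ_iff_lt_or_eq.1 hi
    · have hmono : Monotone (nullControllable A B) :=
        monotone_nat_of_le_succ (nullControllable_le_succ A B)
      have hPx : P x = x := hp' x (hmono hi' hx)
      rw [hPx, sub_self, map_zero, add_zero]
      exact hf i hi' x hx
    · have hsplit : A x + B (f (P x) + v (x - P x)) =
          (A (P x) + B (f (P x))) + (A (x - P x) + B (v (x - P x))) := by
        simp only [map_add, map_sub]
        abel
      rw [hsplit]
      refine Submodule.add_mem _ ?_ (hv _ ?_)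
      · obtain _ | i := i
        · have : P x = 0 := (Submodule.mem_bot k).1 (hPmem x)
          simp [this]
        · exact nullControllable_le_succ A B i (hf i (Nat.lt_succ_self i) _ (hPmem x))
      · have : x - P x ∈ nullControllable A B (i + 1) :=
          Submodule.sub_mem _ hx (nullControllable_le_succ A B i (hPmem x))
        exact this

theorem pow_apply_eq_zero_of_mem_nullControllable {f : V →ₗ[k] U} {j : ℕ}
    (hf : ∀ i < j, ∀ x ∈ nullControllable A B (i + 1), A x + B (f x) ∈ nullControllable A B i)
    {x : V} (hx : x ∈ nullControllable A B j) : ((A + B ∘ₗ f) ^ j) x = 0 := by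
  induction j generalizing x with
  | zero => exact (Submodule.mem_bot k).1 hx
  | succ j ih =>
    rw [pow_succ]
    exact ih (fun i hi => hf i (hi.trans (Nat.lt_succ_self j))) (hf j (Nat.lt_succ_self j) x hx)

theorem mem_nullControllable_of_sum_eq_zero (j : ℕ) (w : ℕ → U) (x : V)
    (h : (A ^ j) x + ∑ i ∈ Finset.range j, (A ^ i) (B (w i)) = 0) :
    x ∈ nullControllable A B j := by
  induction j generalizing x with
  | zero => simpa [nullControllable] using h
  | succ j ih =>
    -- The control carrying the highest power of `A` is the one applied first.
    have h1 : A x + B (w j) ∈ nullControllable A B j := by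
      refine ih _ ?_
      rw [Finset.sum_range_succ, pow_succ, Module.End.mul_apply] at h
      rw [map_add, ← h]
      abel
    change A x ∈ nullControllable A B j ⊔ LinearMap.range B
    rw [← add_sub_cancel_right (A x) (B (w j))]
    exact Submodule.sub_mem _ (Submodule.mem_sup_left h1) (Submodule.mem_sup_right ⟨_, rfl⟩)

end Deadbeat

/-! ### Controllability yields a stabilizing gain -/

section Stabilizable

open Matrix

variable {n m : ℕ} {A : Matrix (Fin n) (Fin n) ℝ} {B : Matrix (Fin n) (Fin m) ℝ}

theorem Controllable.exists_sum_eq (h : Controllable A B) (y : Fin n → ℝ) :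
    ∃ w : ℕ → Fin m → ℝ, ∑ i ∈ Finset.range n, (A ^ i) *ᵥ (B *ᵥ w i) = y := by
  set M : Matrix (Fin n) (Fin n × Fin m) ℝ :=
    Matrix.of fun (i : Fin n) (p : Fin n × Fin m) => (A ^ (p.1 : ℕ) * B) i p.2 with hM
  have hr : LinearMap.range M.mulVecLin = ⊤ :=
    Submodule.eq_top_of_finrank_eq (by rw [Module.finrank_fin_fun]; exact h)
  obtain ⟨z, hz⟩ := LinearMap.range_eq_top.1 hr y
  refine ⟨fun i l => if hi : i < n then z (⟨i, hi⟩, l) else 0, ?_⟩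
  rw [← hz, Finset.sum_range]
  ext i
  simp only [mulVec_mulVec, mulVecLin_apply, Finset.sum_apply, mulVec, dotProduct,
    Fintype.sum_prod_type, hM, of_apply, Fin.is_lt, dif_pos, Fin.eta]

/-- Every state can be steered to 0 in `n` steps, so the deadbeat feedback makes the closed loop
nilpotent. -/
theorem Controllable.exists_isSchur (h : Controllable A B) :
    ∃ K : Matrix (Fin m) (Fin n) ℝ, IsSchur (A - B * K) := by
  obtain ⟨f, hf⟩ := exists_feedback_nullControllable (toLin' A) (toLin' B) n
  refine ⟨-LinearMap.toMatrix' f, ?_⟩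
  have hmem : ∀ x, x ∈ nullControllable (toLin' A) (toLin' B) n := fun x => by
    obtain ⟨w, hw⟩ := h.exists_sum_eq (-((A ^ n) *ᵥ x))
    refine mem_nullControllable_of_sum_eq_zero _ _ n w x ?_
    simp only [← toLin'_pow, toLin'_apply, hw, add_neg_cancel]
  have hpow : (toLin' A + toLin' B ∘ₗ f) ^ n = 0 :=
    LinearMap.ext fun x => pow_apply_eq_zero_of_mem_nullControllable _ _ hf (hmem x)
  have hmat : (A - B * -LinearMap.toMatrix' f) ^ n = 0 := by
    apply toLin'.injective
    rw [toLin'_pow, Matrix.mul_neg, sub_neg_eq_add, map_add, toLin'_mul, Matrix.toLin'_toMatrix', hpow, map_zero]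
  -- The exponent `n + 1` is nonzero even when `n = 0`.
  refine isSchur_of_norm_pow_lt_one (k := n + 1) n.succ_ne_zero ?_
  rw [pow_succ, hmat, zero_mul, norm_zero]
  exact one_pos

end Stabilizable

theorem contDiff_bilinear {V W Z : Type*} [NormedAddCommGroup V] [NormedSpace ℝ V]
    [NormedAddCommGroup W] [NormedSpace ℝ W] [NormedAddCommGroup Z] [NormedSpace ℝ Z]
    [FiniteDimensional ℝ V] [FiniteDimensional ℝ W] (f : V →ₗ[ℝ] W →ₗ[ℝ] Z) {k : ℕ∞ω} :
    ContDiff ℝ k fun p : V × W => f p.1 p.2 := by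
  let g : V →L[ℝ] W →L[ℝ] Z :=
    LinearMap.toContinuousLinearMap (LinearMap.toContinuousLinearMap.toLinearMap ∘ₗ f)
  exact (g.contDiff.comp contDiff_fst).clm_apply contDiff_snd

/-! ### The cost through `X` and `Y`; the exact difference identity -/

section Problem

open Matrix Filter Topology
open scoped MatrixOrder

theorem contDiffAt_mul {m n p : ℕ} {E : Type*} [NormedAddCommGroup E] [NormedSpace ℝ E]
    {f : E → Matrix (Fin m) (Fin n) ℝ} {g : E → Matrix (Fin n) (Fin p) ℝ} {x : E} {k : ℕ∞ω}
    (hf : ContDiffAt ℝ k f x) (hg : ContDiffAt ℝ k g x) :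
    ContDiffAt ℝ k (fun y => f y * g y) x :=
  (contDiff_bilinear (LinearMap.mk₂ ℝ
    (fun (M : Matrix (Fin m) (Fin n) ℝ) (N : Matrix (Fin n) (Fin p) ℝ) => M * N)
    Matrix.add_mul (fun c M N => Matrix.smul_mul c M N) Matrix.mul_add
    (fun c M N => Matrix.mul_smul M c N))).contDiffAt.comp x (hf.prodMk hg)

theorem contDiffAt_trace {n : ℕ} {E : Type*} [NormedAddCommGroup E] [NormedSpace ℝ E]
    {f : E → Matrix (Fin n) (Fin n) ℝ} {x : E} {k : ℕ∞ω} (hf : ContDiffAt ℝ k f x) :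
    ContDiffAt ℝ k (fun y => (f y).trace) x :=
  (contDiff_linearMap (traceLinearMap (Fin n) ℝ ℝ)).contDiffAt.comp x hf

theorem contDiffAt_transpose {m n : ℕ} {E : Type*} [NormedAddCommGroup E] [NormedSpace ℝ E]
    {f : E → Matrix (Fin m) (Fin n) ℝ} {x : E} {k : ℕ∞ω} (hf : ContDiffAt ℝ k f x) :
    ContDiffAt ℝ k (fun y => (f y)ᵀ) x :=
  contDiff_transpose.contDiffAt.comp x hf

variable {n m : ℕ} {A : Matrix (Fin n) (Fin n) ℝ} {B : Matrix (Fin n) (Fin m) ℝ}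
  {Q : Matrix (Fin n) (Fin n) ℝ} {R : Matrix (Fin m) (Fin m) ℝ} {x₀ : Fin n → Fin n → ℝ}
  {K L : Matrix (Fin m) (Fin n) ℝ}

theorem initCov_posDef (hx₀ : LinearIndependent ℝ x₀) : (initCov x₀).PosDef := by
  have h : initCov x₀ = (Matrix.of x₀)ᴴ * Matrix.of x₀ := by
    ext i j
    simp [initCov, Matrix.sum_apply, vecMulVec_apply, mul_apply]
  rw [h]
  refine PosDef.conjTranspose_mul_self _ (mulVec_injective_iff_isUnit.2 ?_)
  exact linearIndependent_rows_iff_isUnit.1 hx₀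

theorem isSchur_closedLoop (hK : K ∈ stabilizing A B) : IsSchur (closedLoop A B K) := hK

theorem stageCost_nonneg (hQ : Q.PosSemidef) (hR : R.PosDef) (K : Matrix (Fin m) (Fin n) ℝ) :
    0 ≤ Kᵀ * R * K + Q :=
  add_nonneg (transpose_mul_mul_nonneg hR.posSemidef.nonneg K) hQ.nonneg

theorem valueMatrix_eq (hK : K ∈ stabilizing A B) :
    (closedLoop A B K)ᵀ * valueMatrix A B Q R K * closedLoop A B K + (Kᵀ * R * K + Q) =
      valueMatrix A B Q R K :=
  (isSchur_closedLoop hK).lyapunovSol_eq _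

theorem covMatrix_eq (hK : K ∈ stabilizing A B) :
    closedLoop A B K * covMatrix A B x₀ K * (closedLoop A B K)ᵀ + initCov x₀ =
      covMatrix A B x₀ K := by
  have := (isSchur_closedLoop hK).transpose.lyapunovSol_eq (initCov x₀)
  rwa [transpose_transpose] at this

theorem valueMatrix_nonneg (hQ : Q.PosSemidef) (hR : R.PosDef) (hK : K ∈ stabilizing A B) :
    0 ≤ valueMatrix A B Q R K :=
  (isSchur_closedLoop hK).lyapunovSol_nonneg (stageCost_nonneg hQ hR K)

theorem initCov_nonneg (x₀ : Fin n → Fin n → ℝ) : 0 ≤ initCov x₀ := by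
  have h : initCov x₀ = (Matrix.of x₀)ᵀ * Matrix.of x₀ := by
    ext i j
    simp [initCov, Matrix.sum_apply, vecMulVec_apply, mul_apply]
  exact h ▸ transpose_mul_self_nonneg _

theorem initCov_le_covMatrix (hK : K ∈ stabilizing A B) : initCov x₀ ≤ covMatrix A B x₀ K :=
  (isSchur_closedLoop hK).transpose.le_lyapunovSol (initCov_nonneg x₀)

theorem covMatrix_nonneg (hK : K ∈ stabilizing A B) : 0 ≤ covMatrix A B x₀ K :=
  (initCov_nonneg x₀).trans (initCov_le_covMatrix hK)

theorem covMatrix_posDef (hx₀ : LinearIndependent ℝ x₀) (hK : K ∈ stabilizing A B) :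
    (covMatrix A B x₀ K).PosDef := by
  simpa using (initCov_posDef hx₀).add_posSemidef
    (sub_nonneg.2 (initCov_le_covMatrix (x₀ := x₀) hK)).posSemidef

theorem stateCost_eq (hK : K ∈ stabilizing A B) (x : Fin n → ℝ) :
    stateCost A B Q R x K = x ⬝ᵥ valueMatrix A B Q R K *ᵥ x := by
  have hc : Continuous fun Z : Matrix (Fin n) (Fin n) ℝ => x ⬝ᵥ Z *ᵥ x := by fun_prop
  let φ : Matrix (Fin n) (Fin n) ℝ →+ ℝ :=
    { toFun := fun Z => x ⬝ᵥ Z *ᵥ x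
      map_zero' := by simp
      map_add' := by simp [add_mulVec] }
  have h := ((isSchur_closedLoop hK).hasSum_lyapunov (Kᵀ * R * K + Q)).map φ hc
  refine Eq.trans (tsum_congr fun k => ?_) h.tsum_eq
  simp only [φ, Function.comp_apply, AddMonoidHom.coe_mk, ZeroHom.coe_mk, mulVec_neg,
    neg_dotProduct_neg, Matrix.mul_add, Matrix.add_mul, add_mulVec, dotProduct_add]
  rw [add_comm]
  simp only [← mulVec_mulVec, dotProduct_mulVec, vecMul_transpose]

theorem cost_eq (hK : K ∈ stabilizing A B) :
    cost A B Q R x₀ K = (valueMatrix A B Q R K * initCov x₀).trace := by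
  simp only [cost, stateCost_eq hK, initCov, Matrix.mul_sum, trace_sum, mul_vecMulVec,
    trace_vecMulVec]
  exact Finset.sum_congr rfl fun j _ => dotProduct_comm _ _

/-- Adjointness: substitute `Σ = Y - A_K Y A_Kᵀ` and cycle the trace. As `P` is arbitrary, this
turns any Lyapunov inequality into a bound on `Y`. -/
theorem trace_mul_initCov (hK : K ∈ stabilizing A B) (P : Matrix (Fin n) (Fin n) ℝ) :
    (P * initCov x₀).trace =
      ((P - (closedLoop A B K)ᵀ * P * closedLoop A B K) * covMatrix A B x₀ K).trace := by
  rw [eq_sub_of_add_eq' (covMatrix_eq (x₀ := x₀) hK), Matrix.mul_sub, Matrix.sub_mul, trace_sub,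
    trace_sub]
  congr 1
  rw [← Matrix.mul_assoc, trace_mul_comm]
  simp only [Matrix.mul_assoc]

theorem cost_eq_trace_mul_covMatrix (hK : K ∈ stabilizing A B) :
    cost A B Q R x₀ K = ((Kᵀ * R * K + Q) * covMatrix A B x₀ K).trace := by
  rw [cost_eq hK, trace_mul_initCov hK, ← eq_sub_of_add_eq' (valueMatrix_eq hK)]

theorem cost_sub_trace (hK : K ∈ stabilizing A B) (P : Matrix (Fin n) (Fin n) ℝ) :
    cost A B Q R x₀ K - (P * initCov x₀).trace =
      (((closedLoop A B K)ᵀ * P * closedLoop A B K + Kᵀ * R * K + Q - P) *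
        covMatrix A B x₀ K).trace := by
  rw [cost_eq_trace_mul_covMatrix hK, trace_mul_initCov hK, ← trace_sub, ← Matrix.sub_mul]
  congr 2
  abel

/-- `R K - Bᵀ X(K) A_K`. -/
def gradFactor (A : Matrix (Fin n) (Fin n) ℝ) (B : Matrix (Fin n) (Fin m) ℝ)
    (Q : Matrix (Fin n) (Fin n) ℝ) (R : Matrix (Fin m) (Fin m) ℝ)
    (K : Matrix (Fin m) (Fin n) ℝ) : Matrix (Fin m) (Fin n) ℝ :=
  R * K - Bᵀ * valueMatrix A B Q R K * closedLoop A B K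

/-- `R + Bᵀ X(K) B`. -/
def inputWeight (A : Matrix (Fin n) (Fin n) ℝ) (B : Matrix (Fin n) (Fin m) ℝ)
    (Q : Matrix (Fin n) (Fin n) ℝ) (R : Matrix (Fin m) (Fin m) ℝ)
    (K : Matrix (Fin m) (Fin n) ℝ) : Matrix (Fin m) (Fin m) ℝ :=
  R + Bᵀ * valueMatrix A B Q R K * B

theorem le_inputWeight (hQ : Q.PosSemidef) (hR : R.PosDef) (hK : K ∈ stabilizing A B) :
    R ≤ inputWeight A B Q R K :=
  le_add_of_nonneg_right (transpose_mul_mul_nonneg (valueMatrix_nonneg hQ hR hK) B)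

/-- Since `A_L = A_K - B (L - K)`, the left side is quadratic in `L - K`; its constant term is the
Lyapunov residual of `X(K)`, which vanishes. -/
theorem bellman_defect (hQ : Q.PosSemidef) (hR : R.PosDef) (hK : K ∈ stabilizing A B)
    (L : Matrix (Fin m) (Fin n) ℝ) :
    (closedLoop A B L)ᵀ * valueMatrix A B Q R K * closedLoop A B L + Lᵀ * R * L + Q -
        valueMatrix A B Q R K =
      (L - K)ᵀ * inputWeight A B Q R K * (L - K) + (L - K)ᵀ * gradFactor A B Q R K +
        (gradFactor A B Q R K)ᵀ * (L - K) := by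
  have hX := transpose_eq_of_nonneg (valueMatrix_nonneg hQ hR hK)
  have hR' := transpose_eq_of_nonneg hR.posSemidef.nonneg
  obtain ⟨D, rfl⟩ : ∃ D, L = K + D := ⟨L - K, by abel⟩
  have hF : closedLoop A B (K + D) = closedLoop A B K - B * D := by
    simp only [closedLoop, Matrix.mul_add]
    abel
  have e := valueMatrix_eq (Q := Q) (R := R) hK
  rw [hF, add_sub_cancel_left, gradFactor, inputWeight, ← sub_eq_zero]
  rw [← sub_eq_zero] at e
  -- Replace 0 by that residual, so that both sides agree on expansion.
  conv_rhs => rw [← e]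
  simp only [transpose_sub, transpose_add, transpose_mul, transpose_transpose, Matrix.mul_sub,
    Matrix.sub_mul, Matrix.mul_add, Matrix.add_mul, Matrix.mul_assoc, hX, hR']
  abel

theorem cost_sub_cost (hQ : Q.PosSemidef) (hR : R.PosDef) (hK : K ∈ stabilizing A B)
    (hL : L ∈ stabilizing A B) :
    cost A B Q R x₀ L - cost A B Q R x₀ K =
      (((L - K)ᵀ * inputWeight A B Q R K * (L - K) + (L - K)ᵀ * gradFactor A B Q R K +
        (gradFactor A B Q R K)ᵀ * (L - K)) * covMatrix A B x₀ L).trace := by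
  rw [← bellman_defect hQ hR hK, cost_eq hK, cost_sub_trace hL]

end Problem

/-! ### Riemannian metric and gradient -/

section Geometry

open Matrix Filter Topology
open scoped MatrixOrder

variable {n m : ℕ} {A : Matrix (Fin n) (Fin n) ℝ} {B : Matrix (Fin n) (Fin m) ℝ}
  {Q : Matrix (Fin n) (Fin n) ℝ} {R : Matrix (Fin m) (Fin m) ℝ} {x₀ : Fin n → Fin n → ℝ}
  {K L : Matrix (Fin m) (Fin n) ℝ}

theorem contDiff_closedLoop : ContDiff ℝ ∞ (closedLoop A B) :=
  contDiff_iff_contDiffAt.2 fun _ =>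
    contDiffAt_const.sub (contDiffAt_mul contDiffAt_const contDiffAt_id)

theorem isOpen_stabilizing : IsOpen (stabilizing A B) :=
  isOpen_isSchur.preimage (contDiff_closedLoop (A := A) (B := B)).continuous

theorem contDiffAt_valueMatrix (hK : K ∈ stabilizing A B) :
    ContDiffAt ℝ ∞ (valueMatrix A B Q R) K :=
  contDiffAt_lyapunovSol contDiff_closedLoop.contDiffAt
    ((contDiffAt_mul (contDiffAt_mul (contDiffAt_transpose contDiffAt_id) contDiffAt_const)
      contDiffAt_id).add contDiffAt_const) (isSchur_closedLoop hK)

theorem contDiffAt_covMatrix (hK : K ∈ stabilizing A B) :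
    ContDiffAt ℝ ∞ (covMatrix A B x₀) K :=
  contDiffAt_lyapunovSol (contDiffAt_transpose contDiff_closedLoop.contDiffAt)
    contDiffAt_const (isSchur_closedLoop hK).transpose

theorem eventually_mem_stabilizing (hK : K ∈ stabilizing A B) :
    ∀ᶠ L in 𝓝 K, L ∈ stabilizing A B :=
  isOpen_stabilizing.mem_nhds hK

theorem contDiffAt_matPow_covMatrix (hx₀ : LinearIndependent ℝ x₀) (hK : K ∈ stabilizing A B)
    (s : ℝ) : ContDiffAt ℝ ∞ (fun L => matPow (covMatrix A B x₀ L) s) K :=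
  contDiffAt_matPow (contDiffAt_covMatrix hK) (covMatrix_posDef hx₀ hK)
    ((eventually_mem_stabilizing hK).mono fun _ hL => (covMatrix_posDef hx₀ hL).1) s

theorem contDiffAt_cost (hK : K ∈ stabilizing A B) : ContDiffAt ℝ ∞ (cost A B Q R x₀) K := by
  refine (contDiffAt_trace (contDiffAt_mul (contDiffAt_valueMatrix (Q := Q) (R := R) hK)
    (contDiffAt_const (c := initCov x₀)))).congr_of_eventuallyEq ?_
  filter_upwards [eventually_mem_stabilizing hK] with L hL
  exact cost_eq hL

theorem contDiffAt_gradFactor (hK : K ∈ stabilizing A B) :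
    ContDiffAt ℝ ∞ (gradFactor A B Q R) K :=
  (contDiffAt_mul contDiffAt_const contDiffAt_id).sub
    (contDiffAt_mul (contDiffAt_mul contDiffAt_const (contDiffAt_valueMatrix hK))
      contDiff_closedLoop.contDiffAt)

theorem contDiffAt_natGrad (hx₀ : LinearIndependent ℝ x₀) (γ : ℝ) (hK : K ∈ stabilizing A B) :
    ContDiffAt ℝ ∞ (natGrad A B Q R x₀ γ) K :=
  (contDiffAt_mul (contDiffAt_gradFactor hK) (contDiffAt_matPow_covMatrix hx₀ hK _)).const_smul
    (2 : ℝ)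

theorem trace_transpose_mul_mul_comm {Y : Matrix (Fin n) (Fin n) ℝ} (hY : Yᵀ = Y)
    (E F : Matrix (Fin m) (Fin n) ℝ) : (Eᵀ * F * Y).trace = (Fᵀ * E * Y).trace := by
  rw [← trace_transpose, transpose_mul, transpose_mul, transpose_transpose, hY, trace_mul_comm]

/-- Along `K + t D` the difference identity reads `f(K) + t² a(t) + t b(t)` with `a`, `b`
differentiable, so the derivative is `b(0)`; no formula for the derivative of `X` or `Y` is needed.
-/
theorem fderiv_cost_apply (hQ : Q.PosSemidef) (hR : R.PosDef) (hK : K ∈ stabilizing A B)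
    (D : Matrix (Fin m) (Fin n) ℝ) :
    fderiv ℝ (cost A B Q R x₀) K D =
      2 * ((gradFactor A B Q R K)ᵀ * D * covMatrix A B x₀ K).trace := by
  set M := inputWeight A B Q R K
  set G := gradFactor A B Q R K
  let line : ℝ → Matrix (Fin m) (Fin n) ℝ := fun t => K + t • D
  have hline : ContDiff ℝ ∞ line := contDiff_const.add (contDiff_id.smul contDiff_const)
  have hline0 : line 0 = K := by simp [line]
  have hY : ContDiffAt ℝ ∞ (fun t => covMatrix A B x₀ (line t)) 0 :=
    (show ContDiffAt ℝ ∞ (covMatrix A B x₀) (line 0) from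
      hline0 ▸ contDiffAt_covMatrix hK).comp 0 hline.contDiffAt
  have hdiff : ∀ C : Matrix (Fin n) (Fin n) ℝ,
      DifferentiableAt ℝ (fun t => (C * covMatrix A B x₀ (line t)).trace) 0 := fun C =>
    (contDiffAt_trace (contDiffAt_mul contDiffAt_const hY)).differentiableAt (by simp)
  set a : ℝ → ℝ := fun t => ((Dᵀ * M * D) * covMatrix A B x₀ (line t)).trace
  set b : ℝ → ℝ := fun t => ((Dᵀ * G + Gᵀ * D) * covMatrix A B x₀ (line t)).trace
  have h1 : HasDerivAt (fun t => cost A B Q R x₀ K + (t ^ 2 * a t + t * b t)) (b 0) 0 := by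
    have ha := (hasDerivAt_pow 2 (0 : ℝ)).mul (hdiff (Dᵀ * M * D)).hasDerivAt
    have hb := (hasDerivAt_id (0 : ℝ)).mul (hdiff (Dᵀ * G + Gᵀ * D)).hasDerivAt
    convert! (ha.add hb).const_add (cost A B Q R x₀ K) using 1
    simp [b]
  have h2 : HasDerivAt (fun t => cost A B Q R x₀ (line t)) (b 0) 0 := by
    refine h1.congr_of_eventuallyEq ?_
    have hev : ∀ᶠ t in 𝓝 (0 : ℝ), line t ∈ stabilizing A B :=
      hline.continuous.continuousAt.eventually_mem
        (hline0 ▸ isOpen_stabilizing.mem_nhds hK)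
    filter_upwards [hev] with t ht
    rw [← sub_eq_iff_eq_add', cost_sub_cost hQ hR hK ht]
    simp only [line, a, b, add_sub_cancel_left, transpose_smul, Matrix.smul_mul, Matrix.mul_smul,
      Matrix.add_mul, trace_add, trace_smul, smul_eq_mul]
    ring
  have h3 : HasDerivAt (fun t => cost A B Q R x₀ (line t)) (fderiv ℝ (cost A B Q R x₀) K D) 0 :=
    (((contDiffAt_cost hK).differentiableAt (by simp)).hasFDerivAt.hasLineDerivAt D)
  rw [h3.unique h2]
  simp only [b, hline0, Matrix.add_mul, trace_add]
  rw [trace_transpose_mul_mul_comm (transpose_eq_of_nonneg (covMatrix_nonneg hK)) D G]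
  ring

theorem metric_natGrad (hx₀ : LinearIndependent ℝ x₀) (γ : ℝ) (hK : K ∈ stabilizing A B)
    (D : Matrix (Fin m) (Fin n) ℝ) :
    metric A B x₀ γ K (natGrad A B Q R x₀ γ K) D =
      2 * ((gradFactor A B Q R K)ᵀ * D * covMatrix A B x₀ K).trace := by
  have hY := covMatrix_posDef hx₀ hK
  have h : natGrad A B Q R x₀ γ K =
    (2 : ℝ) • (gradFactor A B Q R K * matPow (covMatrix A B x₀ K) (1 - γ)) := rfl
  rw [metric, h, transpose_smul, transpose_mul, matPow_transpose hY, Matrix.smul_mul,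
    Matrix.smul_mul, trace_smul, smul_eq_mul, Matrix.mul_assoc, Matrix.mul_assoc,
    trace_mul_comm (matPow _ _)]
  simp only [Matrix.mul_assoc]
  rw [matPow_mul_matPow hY, add_sub_cancel, matPow_one hY]

theorem isGradientAt_natGrad (hQ : Q.PosSemidef) (hR : R.PosDef) (hx₀ : LinearIndependent ℝ x₀)
    (γ : ℝ) (hK : K ∈ stabilizing A B) :
    IsGradientAt (metric A B x₀ γ) (cost A B Q R x₀) (natGrad A B Q R x₀ γ K) K := by
  refine ⟨fderiv ℝ (cost A B Q R x₀) K,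
    ((contDiffAt_cost hK).differentiableAt (by simp)).hasFDerivAt, fun D => ?_⟩
  rw [fderiv_cost_apply hQ hR hK, metric_natGrad hx₀ γ hK]

theorem isRiemannianMetricOn_metric (hx₀ : LinearIndependent ℝ x₀) (γ : ℝ) :
    IsRiemannianMetricOn (metric A B x₀ γ) (stabilizing A B) where
  isOpen := isOpen_stabilizing
  add_left K _ E E' F := by simp [metric, Matrix.add_mul]
  smul_left K _ c E F := by simp [metric]
  symm K hK E F :=
    trace_transpose_mul_mul_comm (matPow_transpose (covMatrix_posDef hx₀ hK) γ) E F
  pos K hK E hE := by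
    obtain ⟨σ, hσ, h⟩ := exists_pos_smul_one_le (matPow_posDef (covMatrix_posDef hx₀ hK) γ)
    have : 0 < ‖E‖ := norm_pos_iff.2 hE
    exact (by positivity : 0 < σ * ‖E‖ ^ 2).trans_le (mul_norm_sq_le_trace h E)
  smooth E F K hK := (contDiffAt_trace (contDiffAt_mul contDiffAt_const
    (contDiffAt_matPow_covMatrix hx₀ hK γ))).contDiffWithinAt

end Geometry

/-! ### Compactness, quadratic growth and gradient domination -/

section Estimates

open Matrix Filter Topology
open scoped MatrixOrder

variable {n m : ℕ} {A : Matrix (Fin n) (Fin n) ℝ} {B : Matrix (Fin n) (Fin m) ℝ}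
  {Q : Matrix (Fin n) (Fin n) ℝ} {R : Matrix (Fin m) (Fin m) ℝ} {x₀ : Fin n → Fin n → ℝ}
  {K Kstar : Matrix (Fin m) (Fin n) ℝ}

theorem trace_le_trace {P P' : Matrix (Fin n) (Fin n) ℝ} (h : P ≤ P') : P.trace ≤ P'.trace := by
  have := (sub_nonneg.2 h).posSemidef.trace_nonneg
  rw [trace_sub] at this
  linarith

theorem pow_mul_mul_pow_transpose_le {F Y : Matrix (Fin n) (Fin n) ℝ} {q : ℝ} (hq : 0 ≤ q)
    (h : F * Y * Fᵀ ≤ q • Y) (k : ℕ) : F ^ k * Y * (F ^ k)ᵀ ≤ q ^ k • Y := by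
  induction k with
  | zero => simp
  | succ k ih =>
    have h1 := mul_mul_transpose_nonneg (sub_nonneg.2 h) (F ^ k)
    have e : F ^ k * (q • Y - F * Y * Fᵀ) * (F ^ k)ᵀ =
        q • (F ^ k * Y * (F ^ k)ᵀ) - F ^ (k + 1) * Y * (F ^ (k + 1))ᵀ := by
      simp only [pow_succ, transpose_mul, Matrix.mul_sub, Matrix.sub_mul, Matrix.mul_smul,
        Matrix.smul_mul, Matrix.mul_assoc]
    rw [e, sub_nonneg] at h1
    refine h1.trans ?_
    rw [pow_succ', mul_smul]
    exact smul_le_smul_of_nonneg_left ih hq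

/-- Since `W ≥ σ ≥ (σ/C) Y`, the map `Y ↦ F Y Fᵀ = Y - W` contracts `Y` by the factor `1 - σ/C`;
iterate and take traces. -/
theorem mul_norm_pow_sq_le {F Y W : Matrix (Fin n) (Fin n) ℝ} {σ C : ℝ} (hσ : 0 < σ) (hσC : σ ≤ C)
    (hW : σ • 1 ≤ W) (hYC : Y ≤ C • 1) (hY : F * Y * Fᵀ + W = Y) (hWY : W ≤ Y) (k : ℕ) :
    σ * ‖F ^ k‖ ^ 2 ≤ (1 - σ / C) ^ k * Y.trace := by
  have hC : 0 < C := hσ.trans_le hσC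
  have hq : 0 ≤ 1 - σ / C := sub_nonneg.2 ((div_le_one hC).2 hσC)
  have h1 : F * Y * Fᵀ ≤ (1 - σ / C) • Y := by
    rw [eq_sub_of_add_eq hY, sub_smul, one_smul]
    refine sub_le_sub_left (le_trans ?_ hW) _
    have := smul_le_smul_of_nonneg_left hYC (div_nonneg hσ.le hC.le)
    rwa [smul_smul, div_mul_cancel₀ _ hC.ne'] at this
  have h2 := trace_le_trace (pow_mul_mul_pow_transpose_le hq h1 k)
  rw [trace_smul, smul_eq_mul] at h2
  refine (mul_norm_sq_le_trace (hW.trans hWY) (F ^ k)).trans (le_trans (le_of_eq ?_) h2)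
  rw [Matrix.mul_assoc, trace_mul_comm]

theorem exists_norm_closedLoop_pow_le (hx₀ : LinearIndependent ℝ x₀) (C : ℝ) :
    ∃ k : ℕ, k ≠ 0 ∧ ∀ K ∈ stabilizing A B, (covMatrix A B x₀ K).trace ≤ C →
      ‖closedLoop A B K ^ k‖ ≤ 1 / 2 := by
  obtain ⟨σ, hσ, hW⟩ := exists_pos_smul_one_le (initCov_posDef hx₀)
  -- `C` is an arbitrary real number; the maximum guarantees `0 < σ ≤ C'`.
  set C' := max C (2 * σ)
  have hC' : 0 < C' := lt_max_of_lt_right (by positivity)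
  have hσC : σ ≤ C' := le_trans (by linarith) (le_max_right _ _)
  have hq0 : 0 ≤ 1 - σ / C' := sub_nonneg.2 ((div_le_one hC').2 hσC)
  have hq1 : 1 - σ / C' < 1 := by linarith [div_pos hσ hC']
  have hlim : Tendsto (fun k : ℕ => (1 - σ / C') ^ k * C') atTop (𝓝 0) := by
    simpa using (tendsto_pow_atTop_nhds_zero_of_lt_one hq0 hq1).mul_const C'
  obtain ⟨k, hk, hk0⟩ := ((hlim.eventually_lt_const (show 0 < σ / 4 by positivity)).and
    (eventually_gt_atTop 0)).exists
  refine ⟨k, hk0.ne', fun K hK hKC => ?_⟩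
  have hC1 := hKC.trans (le_max_left C (2 * σ))
  have h := mul_norm_pow_sq_le hσ hσC hW
    ((le_trace_smul_one (covMatrix_nonneg hK)).trans (smul_one_le_smul_one hC1))
    (covMatrix_eq hK) (initCov_le_covMatrix hK) k
  have h2 : (1 - σ / C') ^ k * (covMatrix A B x₀ K).trace ≤ (1 - σ / C') ^ k * C' := by gcongr
  have h3 : ‖closedLoop A B K ^ k‖ ^ 2 ≤ (1 / 2) ^ 2 := by
    refine le_of_mul_le_mul_left ?_ hσ
    linarith
  exact le_of_sq_le_sq h3 (by norm_num)

theorem mul_norm_sq_le_cost (hQ : Q.PosSemidef) {σ l : ℝ} (hl : 0 ≤ l) (hW : σ • 1 ≤ initCov x₀)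
    (hR : l • 1 ≤ R) (hK : K ∈ stabilizing A B) : l * (σ * ‖K‖ ^ 2) ≤ cost A B Q R x₀ K := by
  have hY := covMatrix_nonneg (x₀ := x₀) hK
  calc l * (σ * ‖K‖ ^ 2) ≤ l * (Kᵀ * K * covMatrix A B x₀ K).trace := by
        gcongr
        exact mul_norm_sq_le_trace (hW.trans (initCov_le_covMatrix hK)) K
    _ = ((l • (Kᵀ * K)) * covMatrix A B x₀ K).trace := by simp
    _ ≤ ((Kᵀ * R * K + Q) * covMatrix A B x₀ K).trace := by
        refine trace_mul_le_trace_mul_right ?_ hY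
        exact (smul_transpose_mul_self_le hR K).trans (le_add_of_nonneg_right hQ.nonneg)
    _ = _ := (cost_eq_trace_mul_covMatrix hK).symm

/-- The danger is a limit of gains on the boundary of the stabilizing set, where `f` need not be
continuous. A bound on `Tr Y` puts the sublevel set in the closed set `‖A_K^k‖ ≤ 1/2` for one fixed
`k`, which lies inside the stabilizing set. Boundedness comes from `R ≻ 0` and `Y ≥ Σ`. -/
theorem isCompact_sublevel (hQ : Q.PosSemidef) (hR : R.PosDef) (hx₀ : LinearIndependent ℝ x₀)
    {a C : ℝ} (hC : ∀ K ∈ stabilizing A B, cost A B Q R x₀ K ≤ a →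
      (covMatrix A B x₀ K).trace ≤ C) :
    IsCompact {K | K ∈ stabilizing A B ∧ cost A B Q R x₀ K ≤ a} := by
  obtain ⟨k, hk, hkK⟩ := exists_norm_closedLoop_pow_le (A := A) (B := B) hx₀ C
  set T := {K : Matrix (Fin m) (Fin n) ℝ | ‖closedLoop A B K ^ k‖ ≤ 1 / 2}
  have hcont : Continuous fun K : Matrix (Fin m) (Fin n) ℝ => ‖closedLoop A B K ^ k‖ :=
    (continuous_norm_pow k).comp (contDiff_closedLoop (A := A) (B := B)).continuous
  have hT : IsClosed T := isClosed_le hcont continuous_const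
  have hTS : T ⊆ stabilizing A B := fun K hK =>
    isSchur_of_norm_pow_lt_one hk (lt_of_le_of_lt hK (by norm_num))
  have heq : {K | K ∈ stabilizing A B ∧ cost A B Q R x₀ K ≤ a} =
      T ∩ cost A B Q R x₀ ⁻¹' Set.Iic a := by
    ext K
    exact ⟨fun h => ⟨hkK K h.1 (hC K h.1 h.2), h.2⟩, fun h => ⟨hTS h.1, h.2⟩⟩
  have hcl : IsClosed {K | K ∈ stabilizing A B ∧ cost A B Q R x₀ K ≤ a} := by
    rw [heq]
    exact ContinuousOn.preimage_isClosed_of_isClosed (fun K hK =>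
      (contDiffAt_cost (hTS hK)).continuousAt.continuousWithinAt) hT isClosed_Iic
  obtain ⟨σ, hσ, hW⟩ := exists_pos_smul_one_le (initCov_posDef hx₀)
  obtain ⟨l, hl, hRl⟩ := exists_pos_smul_one_le hR
  have hbd : Bornology.IsBounded {K | K ∈ stabilizing A B ∧ cost A B Q R x₀ K ≤ a} := by
    refine (isBounded_iff_forall_norm_le).2 ⟨√(a / (l * σ)), fun K hK => ?_⟩
    have h := (mul_norm_sq_le_cost hQ hl.le hW hRl hK.1).trans hK.2
    refine Real.le_sqrt_of_sq_le ?_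
    rw [le_div_iff₀ (by positivity)]
    linarith
  have : ProperSpace (Matrix (Fin m) (Fin n) ℝ) := FiniteDimensional.proper ℝ _
  exact Metric.isCompact_of_isClosed_isBounded hcl hbd

theorem exists_trace_covMatrix_le_of_posDef (hQ : Q.PosDef) (hR : R.PosDef) (a : ℝ) :
    ∃ C, ∀ K ∈ stabilizing A B, cost A B Q R x₀ K ≤ a → (covMatrix A B x₀ K).trace ≤ C := by
  obtain ⟨q, hq, hQq⟩ := exists_pos_smul_one_le hQ
  refine ⟨a / q, fun K hK hKa => ?_⟩
  rw [le_div_iff₀ hq]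
  refine le_trans ?_ hKa
  rw [cost_eq_trace_mul_covMatrix hK]
  refine le_trans (le_of_eq ?_) (trace_mul_le_trace_mul_right (hQq.trans
    (le_add_of_nonneg_left (transpose_mul_mul_nonneg hR.posSemidef.nonneg K)))
    (covMatrix_nonneg hK))
  simp [mul_comm]

theorem exists_isOptimal (hAB : Controllable A B) (hQ : Q.PosDef) (hR : R.PosDef)
    (hx₀ : LinearIndependent ℝ x₀) : ∃ K, IsOptimal A B Q R x₀ K := by
  obtain ⟨K₀, hK₀⟩ := hAB.exists_isSchur
  obtain ⟨C, hC⟩ := exists_trace_covMatrix_le_of_posDef (A := A) (B := B) (x₀ := x₀) hQ hR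
    (cost A B Q R x₀ K₀)
  obtain ⟨K, hK, hmin⟩ := (isCompact_sublevel hQ.posSemidef hR hx₀ hC).exists_isMinOn
    ⟨K₀, hK₀, le_rfl⟩ (fun K hK => (contDiffAt_cost hK.1).continuousAt.continuousWithinAt)
  refine ⟨K, hK.1, fun L hL => ?_⟩
  obtain h | h := le_total (cost A B Q R x₀ L) (cost A B Q R x₀ K₀)
  · exact hmin ⟨hL, h⟩
  · exact hK.2.trans h

theorem IsOptimal.gradFactor_eq_zero (hQ : Q.PosSemidef) (hR : R.PosDef)
    (hx₀ : LinearIndependent ℝ x₀) (h : IsOptimal A B Q R x₀ Kstar) :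
    gradFactor A B Q R Kstar = 0 := by
  have hmin : IsLocalMin (cost A B Q R x₀) Kstar :=
    (eventually_mem_stabilizing h.1).mono fun L hL => h.2 L hL
  -- Test the vanishing derivative in the direction of the gradient factor itself.
  have h0 : (0 : ℝ) = _ := (DFunLike.congr_fun hmin.fderiv_eq_zero _).symm.trans
    (fderiv_cost_apply (x₀ := x₀) hQ hR h.1 (gradFactor A B Q R Kstar))
  obtain ⟨σ, hσ, hY⟩ := exists_pos_smul_one_le (covMatrix_posDef hx₀ h.1)
  have h1 := mul_norm_sq_le_trace hY (gradFactor A B Q R Kstar)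
  have h2 : σ * ‖gradFactor A B Q R Kstar‖ ^ 2 ≤ 0 := by
    linarith
  have h3 : ‖gradFactor A B Q R Kstar‖ ^ 2 ≤ 0 := by
    by_contra! hc
    exact absurd h2 (not_le.2 (mul_pos hσ hc))
  exact norm_eq_zero.1 (pow_eq_zero_iff two_ne_zero |>.1 (le_antisymm h3 (sq_nonneg _)))

theorem IsOptimal.cost_sub (hQ : Q.PosSemidef) (hR : R.PosDef) (hx₀ : LinearIndependent ℝ x₀)
    (h : IsOptimal A B Q R x₀ Kstar) (hK : K ∈ stabilizing A B) :
    cost A B Q R x₀ K - cost A B Q R x₀ Kstar =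
      ((K - Kstar)ᵀ * inputWeight A B Q R Kstar * (K - Kstar) * covMatrix A B x₀ K).trace := by
  rw [cost_sub_cost hQ hR h.1 hK, h.gradFactor_eq_zero hQ hR hx₀]
  simp

theorem IsOptimal.mul_trace_le (hQ : Q.PosSemidef) (hR : R.PosDef) (hx₀ : LinearIndependent ℝ x₀)
    (h : IsOptimal A B Q R x₀ Kstar) {l : ℝ} (hRl : l • 1 ≤ R) (hK : K ∈ stabilizing A B) :
    l * ((K - Kstar)ᵀ * (K - Kstar) * covMatrix A B x₀ K).trace ≤
      cost A B Q R x₀ K - cost A B Q R x₀ Kstar := by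
  rw [h.cost_sub hQ hR hx₀ hK]
  refine le_trans (le_of_eq ?_) (trace_mul_le_trace_mul_right (smul_transpose_mul_self_le
    (hRl.trans (le_inputWeight hQ hR h.1)) _) (covMatrix_nonneg hK))
  simp

theorem IsOptimal.mul_norm_sub_sq_le (hQ : Q.PosSemidef) (hR : R.PosDef)
    (hx₀ : LinearIndependent ℝ x₀) (h : IsOptimal A B Q R x₀ Kstar) {σ l : ℝ} (hl : 0 ≤ l)
    (hW : σ • 1 ≤ initCov x₀) (hRl : l • 1 ≤ R) (hK : K ∈ stabilizing A B) :
    l * (σ * ‖K - Kstar‖ ^ 2) ≤ cost A B Q R x₀ K - cost A B Q R x₀ Kstar := by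
  refine le_trans ?_ (h.mul_trace_le hQ hR hx₀ hRl hK)
  gcongr
  exact mul_norm_sq_le_trace (hW.trans (initCov_le_covMatrix hK)) _

theorem IsOptimal.eq (hQ : Q.PosSemidef) (hR : R.PosDef) (hx₀ : LinearIndependent ℝ x₀)
    (h : IsOptimal A B Q R x₀ Kstar) (hK : IsOptimal A B Q R x₀ K) : K = Kstar := by
  obtain ⟨σ, hσ, hW⟩ := exists_pos_smul_one_le (initCov_posDef hx₀)
  obtain ⟨l, hl, hRl⟩ := exists_pos_smul_one_le hR
  have h1 := h.mul_norm_sub_sq_le hQ hR hx₀ hl.le hW hRl hK.1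
  have h2 := hK.2 _ h.1
  by_contra hne
  have h3 : 0 < ‖K - Kstar‖ := norm_pos_iff.2 (sub_ne_zero.2 hne)
  have h4 : 0 < l * (σ * ‖K - Kstar‖ ^ 2) := by positivity
  linarith

theorem IsOptimal.cost_sub_le (hQ : Q.PosSemidef) (hR : R.PosDef) (hx₀ : LinearIndependent ℝ x₀)
    (h : IsOptimal A B Q R x₀ Kstar) {μ C : ℝ} (hμ : 0 ≤ μ)
    (hM : inputWeight A B Q R Kstar ≤ μ • 1) (hK : K ∈ stabilizing A B)
    (hY : covMatrix A B x₀ K ≤ C • 1) :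
    cost A B Q R x₀ K - cost A B Q R x₀ Kstar ≤ μ * (C * ‖K - Kstar‖ ^ 2) := by
  rw [h.cost_sub hQ hR hx₀ hK]
  refine (trace_mul_le_trace_mul_right (transpose_mul_mul_le_smul hM _)
    (covMatrix_nonneg hK)).trans ?_
  rw [Matrix.smul_mul, trace_smul, smul_eq_mul]
  gcongr
  exact trace_le_mul_norm_sq hY _

/-- A closed loop is contractive, in the norm of a Lyapunov function of a reference closed loop,
up to the deviation of the gains. -/
theorem lyapunov_perturbation {F P : Matrix (Fin n) (Fin n) ℝ} (hF : Fᵀ * P * F + 1 = P)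
    (hP : 0 ≤ P) {p : ℝ} (hp : 0 < p) (hPp : P ≤ p • 1) (H : Matrix (Fin n) (Fin n) ℝ) :
    p⁻¹ • 1 ≤ P - (F - H)ᵀ * P * (F - H) + (1 + p) • (Hᵀ * P * H) := by
  have hPs := transpose_eq_of_nonneg hP
  have e0 : Fᵀ * (P * F) = P - 1 := by
    rw [← Matrix.mul_assoc]
    exact eq_sub_of_add_eq hF
  -- Complete the square in the cross terms, with weight `p`.
  have e : P - (F - H)ᵀ * P * (F - H) + (1 + p) • (Hᵀ * P * H) - p⁻¹ • 1 =
      p⁻¹ • (p • 1 - P) + p • ((p⁻¹ • F + H)ᵀ * P * (p⁻¹ • F + H)) := by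
    simp only [transpose_sub, transpose_add, transpose_smul, Matrix.mul_sub, Matrix.sub_mul,
      Matrix.mul_add, Matrix.add_mul, Matrix.mul_assoc, Matrix.smul_mul, Matrix.mul_smul, e0]
    match_scalars <;> field_simp <;> ring
  rw [← sub_nonneg, e]
  exact add_nonneg (smul_nonneg (by positivity) (sub_nonneg.2 hPp))
    (smul_nonneg hp.le (transpose_mul_mul_nonneg hP _))

/-- Without `Q ≻ 0` the cost does not control the state directly. The cost gap, however, controls
`Tr (Dᵀ D Y)` for `D = K - K_*`. Pairing `lyapunov_perturbation` at `K_*`, with `H = B D`, against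
`Y(K)` then bounds `Tr Y`. -/
theorem IsOptimal.exists_trace_covMatrix_le (hQ : Q.PosSemidef) (hR : R.PosDef)
    (hx₀ : LinearIndependent ℝ x₀) (h : IsOptimal A B Q R x₀ Kstar) (a : ℝ) :
    ∃ C, ∀ K ∈ stabilizing A B, cost A B Q R x₀ K ≤ a → (covMatrix A B x₀ K).trace ≤ C := by
  have hS := isSchur_closedLoop h.1
  set P := lyapunovSol (closedLoop A B Kstar) 1
  have hP : 0 ≤ P := hS.lyapunovSol_nonneg PosSemidef.one.nonneg
  obtain ⟨p, hp, hPp⟩ : ∃ p > (0 : ℝ), P ≤ p • 1 :=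
    ⟨P.trace + 1, by linarith [hP.posSemidef.trace_nonneg],
      (le_trace_smul_one hP).trans (smul_one_le_smul_one (by linarith))⟩
  obtain ⟨b, hb, hBb⟩ : ∃ b ≥ (0 : ℝ), Bᵀ * P * B ≤ b • 1 :=
    ⟨_, (transpose_mul_mul_nonneg hP B).posSemidef.trace_nonneg,
      le_trace_smul_one (transpose_mul_mul_nonneg hP B)⟩
  obtain ⟨l, hl, hRl⟩ := exists_pos_smul_one_le hR
  refine ⟨p * ((P * initCov x₀).trace + (1 + p) * (b * ((a - cost A B Q R x₀ Kstar) / l))),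
    fun K hK hKa => ?_⟩
  have hY := covMatrix_nonneg (x₀ := x₀) hK
  set D := K - Kstar with hD
  have hF : closedLoop A B K = closedLoop A B Kstar - B * D := by
    simp only [closedLoop, hD, Matrix.mul_sub]
    abel
  have h1 := trace_mul_le_trace_mul_right (lyapunov_perturbation (hS.lyapunovSol_eq 1) hP hp hPp
    (B * D)) hY
  rw [← hF, Matrix.add_mul, trace_add, ← trace_mul_initCov hK, Matrix.smul_mul, Matrix.smul_mul,
    trace_smul, trace_smul, Matrix.one_mul, smul_eq_mul, smul_eq_mul] at h1
  have h2 : ((B * D)ᵀ * P * (B * D) * covMatrix A B x₀ K).trace ≤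
      b * (Dᵀ * D * covMatrix A B x₀ K).trace := by
    have := trace_mul_le_trace_mul_right (transpose_mul_mul_le_smul hBb D) hY
    rw [Matrix.smul_mul, trace_smul, smul_eq_mul] at this
    refine le_trans (le_of_eq ?_) this
    simp only [transpose_mul, Matrix.mul_assoc]
  have h3 : (Dᵀ * D * covMatrix A B x₀ K).trace ≤ (a - cost A B Q R x₀ Kstar) / l := by
    rw [le_div_iff₀ hl, mul_comm]
    exact (h.mul_trace_le hQ hR hx₀ hRl hK).trans (by linarith)
  rw [inv_mul_le_iff₀ hp] at h1
  refine h1.trans ?_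
  gcongr
  exact h2.trans (by gcongr)

/-- Gradient domination. In the difference identity from `K` to `K_*`, the quadratic in `D` is at
least `-l⁻¹ Eᵀ E` by completing the square. The weight is `Y` at the optimum, so `C` does not depend
on `K`. -/
theorem IsOptimal.cost_sub_le_norm_gradFactor (hQ : Q.PosSemidef) (hR : R.PosDef)
    (h : IsOptimal A B Q R x₀ Kstar) {l C : ℝ} (hl : 0 < l) (hRl : l • 1 ≤ R)
    (hC : covMatrix A B x₀ Kstar ≤ C • 1) (hK : K ∈ stabilizing A B) :
    l * (cost A B Q R x₀ K - cost A B Q R x₀ Kstar) ≤ C * ‖gradFactor A B Q R K‖ ^ 2 := by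
  have h1 := cost_sub_cost (x₀ := x₀) hQ hR hK h.1
  set M := inputWeight A B Q R K with hM
  set E := gradFactor A B Q R K
  set D := Kstar - K
  have hlM : l • 1 ≤ M := hRl.trans (le_inputWeight hQ hR hK)
  have e : Dᵀ * M * D + Dᵀ * E + Eᵀ * D + l⁻¹ • (Eᵀ * E) =
      Dᵀ * (M - l • 1) * D + l • ((D + l⁻¹ • E)ᵀ * (D + l⁻¹ • E)) := by
    simp only [transpose_add, transpose_smul, Matrix.mul_sub, Matrix.sub_mul,
      Matrix.mul_add, Matrix.add_mul, Matrix.mul_assoc, Matrix.smul_mul, Matrix.mul_smul,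
      Matrix.one_mul]
    match_scalars <;> field_simp
    ring
  have h2 : 0 ≤ Dᵀ * M * D + Dᵀ * E + Eᵀ * D + l⁻¹ • (Eᵀ * E) := by
    rw [e]
    exact add_nonneg (transpose_mul_mul_nonneg (sub_nonneg.2 hlM) D)
      (smul_nonneg hl.le (transpose_mul_self_nonneg _))
  have h3 := trace_mul_nonneg h2 (covMatrix_nonneg (x₀ := x₀) h.1)
  rw [Matrix.add_mul, trace_add, ← h1, Matrix.smul_mul, trace_smul, smul_eq_mul] at h3
  have h4 := trace_le_mul_norm_sq hC E
  have h5 : cost A B Q R x₀ K - cost A B Q R x₀ Kstar ≤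
      l⁻¹ * (Eᵀ * E * covMatrix A B x₀ Kstar).trace := by linarith
  rw [le_inv_mul_iff₀ hl] at h5
  exact h5.trans h4

/-- The exponent `2 - γ` combines `1 - γ` from the field with 1 from the derivative of the cost. -/
theorem fderiv_cost_natGrad_le (hQ : Q.PosSemidef) (hR : R.PosDef) (hx₀ : LinearIndependent ℝ x₀)
    {γ c : ℝ} (hK : K ∈ stabilizing A B) (hc : c • 1 ≤ matPow (covMatrix A B x₀ K) (2 - γ)) :
    fderiv ℝ (cost A B Q R x₀) K (-natGrad A B Q R x₀ γ K) ≤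
      -(4 * (c * ‖gradFactor A B Q R K‖ ^ 2)) := by
  have hY := covMatrix_posDef hx₀ hK
  have h : natGrad A B Q R x₀ γ K =
    (2 : ℝ) • (gradFactor A B Q R K * matPow (covMatrix A B x₀ K) (1 - γ)) := rfl
  have hpow : matPow (covMatrix A B x₀ K) (1 - γ) * covMatrix A B x₀ K =
      matPow (covMatrix A B x₀ K) (2 - γ) := by
    nth_rw 2 [← matPow_one hY]
    rw [matPow_mul_matPow hY]
    ring_nf
  have h1 : fderiv ℝ (cost A B Q R x₀) K (-natGrad A B Q R x₀ γ K) =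
      -(4 * ((gradFactor A B Q R K)ᵀ * gradFactor A B Q R K *
        matPow (covMatrix A B x₀ K) (2 - γ)).trace) := by
    rw [fderiv_cost_apply hQ hR hK, h, ← hpow]
    simp only [Matrix.mul_neg, Matrix.neg_mul, trace_neg, Matrix.mul_smul, Matrix.smul_mul,
      trace_smul, smul_eq_mul, Matrix.mul_assoc]
    ring
  rw [h1]
  have := mul_norm_sq_le_trace hc (gradFactor A B Q R K)
  linarith

end Estimates

/-- Grönwall: `exp (r s) g(s)` is nonincreasing. -/
theorem le_exp_mul_of_hasDerivWithinAt_le {g g' : ℝ → ℝ} {r : ℝ}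
    (hg : ∀ t, 0 ≤ t → HasDerivWithinAt g (g' t) (Set.Ici 0) t)
    (h : ∀ t, 0 ≤ t → g' t ≤ -r * g t) {t : ℝ} (ht : 0 ≤ t) :
    g t ≤ Real.exp (-r * t) * g 0 := by
  have hd : ∀ s, 0 ≤ s → HasDerivWithinAt (fun s => Real.exp (r * s) * g s)
      (Real.exp (r * s) * (r * g s + g' s)) (Set.Ici 0) s := fun s hs => by
    have h1 : HasDerivAt (fun s => Real.exp (r * s)) (Real.exp (r * s) * r) s := by
      simpa using ((hasDerivAt_id s).const_mul r).exp
    exact (h1.hasDerivWithinAt.mul (hg s hs)).congr_deriv (by ring)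
  have hanti : AntitoneOn (fun s => Real.exp (r * s) * g s) (Set.Ici 0) :=
    antitoneOn_of_hasDerivWithinAt_nonpos (convex_Ici 0)
      (fun s hs => (hd s hs).continuousWithinAt)
      (fun s hs => (hd s (interior_subset hs)).mono interior_subset)
      (fun s hs => mul_nonpos_of_nonneg_of_nonpos (Real.exp_pos _).le
        (by linarith [h s (interior_subset hs)]))
  have h0 := hanti (Set.mem_Ici.2 le_rfl) (Set.mem_Ici.2 ht) ht
  simp only [mul_zero, Real.exp_zero, one_mul] at h0
  calc g t = Real.exp (-r * t) * (Real.exp (r * t) * g t) := by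
        rw [← mul_assoc, ← Real.exp_add]
        simp
    _ ≤ _ := by gcongr

/-! ### The natural gradient flow and its convergence -/

section Flow

open Matrix Filter Topology
open scoped MatrixOrder

variable {n m : ℕ} {A : Matrix (Fin n) (Fin n) ℝ} {B : Matrix (Fin n) (Fin m) ℝ}
  {Q : Matrix (Fin n) (Fin n) ℝ} {R : Matrix (Fin m) (Fin m) ℝ} {x₀ : Fin n → Fin n → ℝ}
  {γ : ℝ} {K₀ Kstar : Matrix (Fin m) (Fin n) ℝ} {K : ℝ → Matrix (Fin m) (Fin n) ℝ}

theorem fderiv_cost_natGrad_nonpos (hQ : Q.PosSemidef) (hR : R.PosDef)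
    (hx₀ : LinearIndependent ℝ x₀) (γ : ℝ) {K : Matrix (Fin m) (Fin n) ℝ}
    (hK : K ∈ stabilizing A B) :
    fderiv ℝ (cost A B Q R x₀) K (-natGrad A B Q R x₀ γ K) ≤ 0 := by
  obtain ⟨c, hc, h⟩ := exists_pos_smul_one_le (matPow_posDef (covMatrix_posDef hx₀ hK) (2 - γ))
  refine (fderiv_cost_natGrad_le hQ hR hx₀ hK h).trans ?_
  rw [Left.neg_nonpos_iff]
  positivity

theorem hasFDerivAt_cost {K : Matrix (Fin m) (Fin n) ℝ} (hK : K ∈ stabilizing A B) :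
    HasFDerivAt (cost A B Q R x₀) (fderiv ℝ (cost A B Q R x₀) K) K :=
  ((contDiffAt_cost hK).differentiableAt (by simp)).hasFDerivAt

theorem IsOptimal.exists_natGradFlow (hQ : Q.PosSemidef) (hR : R.PosDef)
    (hx₀ : LinearIndependent ℝ x₀) (h : IsOptimal A B Q R x₀ Kstar)
    (hK₀ : K₀ ∈ stabilizing A B) :
    ∃ K, IsNatGradFlow A B Q R x₀ γ K₀ K ∧
      ∀ K', IsNatGradFlow A B Q R x₀ γ K₀ K' → Set.EqOn K' K (Set.Ici 0) := by
  obtain ⟨K, ⟨h1, h2, h3⟩, huniq⟩ := exists_unique_flow (U := stabilizing A B)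
    (v := fun K => -natGrad A B Q R x₀ γ K) (φ := cost A B Q R x₀)
    (φ' := fderiv ℝ (cost A B Q R x₀)) isOpen_stabilizing
    (fun K hK => (contDiffAt_natGrad hx₀ γ hK).neg.contDiffWithinAt)
    (fun K hK => hasFDerivAt_cost hK)
    (fun K hK => fderiv_cost_natGrad_nonpos hQ hR hx₀ γ hK)
    (fun a => by
      obtain ⟨C, hC⟩ := h.exists_trace_covMatrix_le hQ hR hx₀ a
      exact isCompact_sublevel hQ hR hx₀ hC) hK₀
  exact ⟨K, ⟨h1, h2, h3⟩, fun K' h' => huniq K' h'.initial h'.mem h'.deriv⟩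

theorem IsNatGradFlow.hasDerivWithinAt_cost (hK : IsNatGradFlow A B Q R x₀ γ K₀ K) {t : ℝ}
    (ht : 0 ≤ t) : HasDerivWithinAt (fun t => cost A B Q R x₀ (K t))
      (fderiv ℝ (cost A B Q R x₀) (K t) (-natGrad A B Q R x₀ γ (K t))) (Set.Ici 0) t :=
  (hasFDerivAt_cost (hK.mem t ht)).comp_hasDerivWithinAt t (hK.deriv t ht)

theorem IsNatGradFlow.cost_le (hQ : Q.PosSemidef) (hR : R.PosDef) (hx₀ : LinearIndependent ℝ x₀)
    (hK : IsNatGradFlow A B Q R x₀ γ K₀ K) {t : ℝ} (ht : 0 ≤ t) :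
    cost A B Q R x₀ (K t) ≤ cost A B Q R x₀ K₀ := by
  have := le_exp_mul_of_hasDerivWithinAt_le (r := 0) (fun s hs => hK.hasDerivWithinAt_cost hs)
    (fun s hs => by simpa using fderiv_cost_natGrad_nonpos hQ hR hx₀ γ (hK.mem s hs)) ht
  simpa [hK.initial] using this

theorem IsOptimal.exists_exponential_decay (hQ : Q.PosSemidef) (hR : R.PosDef)
    (hx₀ : LinearIndependent ℝ x₀) (h : IsOptimal A B Q R x₀ Kstar) (γ a : ℝ) :
    ∃ r > 0, ∃ α > 0, ∃ c > 0,
      ∀ K₀ ∈ stabilizing A B, cost A B Q R x₀ K₀ ≤ a →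
        ∀ K, IsNatGradFlow A B Q R x₀ γ K₀ K → ∀ t, 0 ≤ t →
          cost A B Q R x₀ (K t) - cost A B Q R x₀ Kstar ≤
            Real.exp (-r * t) * (cost A B Q R x₀ K₀ - cost A B Q R x₀ Kstar) ∧
          ‖K t - Kstar‖ ^ 2 ≤ c * Real.exp (-α * t) * ‖K₀ - Kstar‖ ^ 2 := by
  obtain ⟨σ, hσ, hW⟩ := exists_pos_smul_one_le (initCov_posDef hx₀)
  obtain ⟨l, hl, hRl⟩ := exists_pos_smul_one_le hR
  -- The cost decreases along the flow, so this bound on `Y`, uniform on the sublevel set, holds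
  -- along the whole trajectory.
  obtain ⟨C, hC0, hC⟩ : ∃ C > (0 : ℝ), ∀ K ∈ stabilizing A B, cost A B Q R x₀ K ≤ a →
      covMatrix A B x₀ K ≤ C • 1 := by
    obtain ⟨C, hC⟩ := h.exists_trace_covMatrix_le hQ hR hx₀ a
    exact ⟨max C 1, lt_max_of_lt_right one_pos, fun K hK hKa =>
      (le_trace_smul_one (covMatrix_nonneg hK)).trans
        (smul_one_le_smul_one ((hC K hK hKa).trans (le_max_left _ _)))⟩
  obtain ⟨Cs, hCs0, hCs⟩ : ∃ Cs > (0 : ℝ), covMatrix A B x₀ Kstar ≤ Cs • 1 :=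
    ⟨max (covMatrix A B x₀ Kstar).trace 1, lt_max_of_lt_right one_pos,
      (le_trace_smul_one (covMatrix_nonneg h.1)).trans (smul_one_le_smul_one (le_max_left _ _))⟩
  obtain ⟨μ, hμ0, hμ⟩ : ∃ μ > (0 : ℝ), inputWeight A B Q R Kstar ≤ μ • 1 :=
    ⟨max (inputWeight A B Q R Kstar).trace 1, lt_max_of_lt_right one_pos,
      (le_trace_smul_one (hR.posSemidef.nonneg.trans (le_inputWeight hQ hR h.1))).trans
        (smul_one_le_smul_one (le_max_left _ _))⟩
  set c := min (σ ^ (2 - γ)) (C ^ (2 - γ))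
  have hc : 0 < c := lt_min (Real.rpow_pos_of_pos hσ _) (Real.rpow_pos_of_pos hC0 _)
  -- The rate is dissipation (`4 c`) times gradient domination (`l / Cs`). The constant for
  -- distances is the ratio of the upper (`μ C`) to the lower (`l σ`) quadratic bound of the cost
  -- gap.
  refine ⟨4 * c * l / Cs, by positivity, 4 * c * l / Cs, by positivity, μ * C / (l * σ),
    by positivity, fun K₀ hK₀ hK₀a K hK t ht => ?_⟩
  have hdecay : ∀ s, 0 ≤ s → fderiv ℝ (cost A B Q R x₀) (K s) (-natGrad A B Q R x₀ γ (K s)) ≤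
      -(4 * c * l / Cs) * (cost A B Q R x₀ (K s) - cost A B Q R x₀ Kstar) := fun s hs => by
    have hs' := hK.mem s hs
    have h1 := fderiv_cost_natGrad_le hQ hR hx₀ hs' (smul_one_le_matPow hσ
      (hW.trans (initCov_le_covMatrix hs'))
      (hC _ hs' ((hK.cost_le hQ hR hx₀ hs).trans hK₀a)) (2 - γ))
    have h2 := h.cost_sub_le_norm_gradFactor hQ hR hl hRl hCs hs'
    have h3 : l * (cost A B Q R x₀ (K s) - cost A B Q R x₀ Kstar) / Cs ≤
        ‖gradFactor A B Q R (K s)‖ ^ 2 := by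
      rwa [div_le_iff₀ hCs0, mul_comm _ Cs]
    have h4 := mul_le_mul_of_nonneg_left h3 hc.le
    refine h1.trans ?_
    rw [neg_mul, neg_le_neg_iff]
    calc 4 * c * l / Cs * (cost A B Q R x₀ (K s) - cost A B Q R x₀ Kstar) =
        4 * (c * (l * (cost A B Q R x₀ (K s) - cost A B Q R x₀ Kstar) / Cs)) := by ring
      _ ≤ _ := by gcongr
  have hcost := le_exp_mul_of_hasDerivWithinAt_le
    (g := fun s => cost A B Q R x₀ (K s) - cost A B Q R x₀ Kstar)
    (fun s hs => (hK.hasDerivWithinAt_cost hs).sub_const _) hdecay ht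
  simp only [hK.initial] at hcost
  refine ⟨hcost, ?_⟩
  have h1 := h.mul_norm_sub_sq_le hQ hR hx₀ hl.le hW hRl (hK.mem t ht)
  have h2 := h.cost_sub_le hQ hR hx₀ hμ0.le hμ hK₀ (hC _ hK₀ hK₀a)
  have h3 : (l * σ) * ‖K t - Kstar‖ ^ 2 ≤
      Real.exp (-(4 * c * l / Cs) * t) * (μ * (C * ‖K₀ - Kstar‖ ^ 2)) := by
    rw [mul_assoc]
    exact h1.trans (hcost.trans (by gcongr))
  rw [← le_div_iff₀' (by positivity)] at h3
  refine h3.trans (le_of_eq ?_)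
  ring

theorem IsOptimal.exists_exponential_stability (hQ : Q.PosSemidef) (hR : R.PosDef)
    (hx₀ : LinearIndependent ℝ x₀) (h : IsOptimal A B Q R x₀ Kstar) (γ : ℝ) :
    ∃ δ > 0, ∃ α > 0, ∃ c > 0,
      ∀ K₀, ‖K₀ - Kstar‖ < δ → K₀ ∈ stabilizing A B ∧
        ∀ K, IsNatGradFlow A B Q R x₀ γ K₀ K → ∀ t, 0 ≤ t →
          ‖K t - Kstar‖ ^ 2 ≤ c * Real.exp (-α * t) * ‖K₀ - Kstar‖ ^ 2 := by
  -- Any level above the minimum works: by continuity its sublevel set contains a ball around `K_*`.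
  obtain ⟨_, _, α, hα, c, hc, hdecay⟩ :=
    h.exists_exponential_decay hQ hR hx₀ γ (cost A B Q R x₀ Kstar + 1)
  have hev : ∀ᶠ K in 𝓝 Kstar, K ∈ stabilizing A B ∧
      cost A B Q R x₀ K < cost A B Q R x₀ Kstar + 1 :=
    (eventually_mem_stabilizing h.1).and
      ((contDiffAt_cost h.1).continuousAt.eventually_lt continuousAt_const (lt_add_one _))
  obtain ⟨δ, hδ, hball⟩ := Metric.eventually_nhds_iff.1 hev
  refine ⟨δ, hδ, α, hα, c, hc, fun K₀ hK₀ => ?_⟩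
  have hK₀' := hball (by rwa [dist_eq_norm])
  exact ⟨hK₀'.1, fun K hK t ht => (hdecay K₀ hK₀'.1 hK₀'.2.le K hK t ht).2⟩

end Flow

end LQR

end

theorem mainTheorem6 {n m : ℕ}
    (A : Matrix (Fin n) (Fin n) ℝ) (B : Matrix (Fin n) (Fin m) ℝ)
    (Q : Matrix (Fin n) (Fin n) ℝ) (R : Matrix (Fin m) (Fin m) ℝ)
    (x₀ : Fin n → Fin n → ℝ) (γ : ℝ)
    (hAB : LQR.Controllable A B) (hQ : Q.PosSemidef) (hR : R.PosDef)
    (hx₀ : LinearIndependent ℝ x₀) (hγ : 0 < γ) :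
    -- the optimal gain exists and is unique when `Q` is positive definite
    (Q.PosDef → ∃! Kstar, LQR.IsOptimal A B Q R x₀ Kstar) ∧
    -- the metric, and the flow as the negative gradient field of the cost
    LQR.IsRiemannianMetricOn (LQR.metric A B x₀ γ) (LQR.stabilizing A B) ∧
    (∀ K ∈ LQR.stabilizing A B,
      LQR.IsGradientAt (LQR.metric A B x₀ γ) (LQR.cost A B Q R x₀)
        (LQR.natGrad A B Q R x₀ γ K) K) ∧
    ∀ Kstar, LQR.IsOptimal A B Q R x₀ Kstar →
      -- there is exactly one solution of the flow from each stabilizing gain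
      (∀ K₀ ∈ LQR.stabilizing A B,
        ∃ K, LQR.IsNatGradFlow A B Q R x₀ γ K₀ K ∧
          ∀ K', LQR.IsNatGradFlow A B Q R x₀ γ K₀ K' → Set.EqOn K' K (Set.Ici 0)) ∧
      -- exponential decay of the energy and of the distance to the optimal gain, with
      -- constants that are uniform over each sublevel set of the cost
      (∀ a : ℝ, ∃ r > 0, ∃ α > 0, ∃ c > 0,
        ∀ K₀ ∈ LQR.stabilizing A B, LQR.cost A B Q R x₀ K₀ ≤ a →
          ∀ K, LQR.IsNatGradFlow A B Q R x₀ γ K₀ K → ∀ t, 0 ≤ t →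
            LQR.cost A B Q R x₀ (K t) - LQR.cost A B Q R x₀ Kstar ≤
              Real.exp (-r * t) * (LQR.cost A B Q R x₀ K₀ - LQR.cost A B Q R x₀ Kstar) ∧
            ‖K t - Kstar‖ ^ 2 ≤ c * Real.exp (-α * t) * ‖K₀ - Kstar‖ ^ 2) ∧
      -- local exponential stability of the optimal gain
      (∃ δ > 0, ∃ α > 0, ∃ c > 0,
        ∀ K₀, ‖K₀ - Kstar‖ < δ → K₀ ∈ LQR.stabilizing A B ∧
          ∀ K, LQR.IsNatGradFlow A B Q R x₀ γ K₀ K → ∀ t, 0 ≤ t →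
            ‖K t - Kstar‖ ^ 2 ≤ c * Real.exp (-α * t) * ‖K₀ - Kstar‖ ^ 2) := by
  refine ⟨fun hQ' => ?_, LQR.isRiemannianMetricOn_metric hx₀ γ,
    fun K hK => LQR.isGradientAt_natGrad hQ hR hx₀ γ hK, fun Kstar h =>
      ⟨fun K₀ hK₀ => h.exists_natGradFlow hQ hR hx₀ hK₀, h.exists_exponential_decay hQ hR hx₀ γ,
        h.exists_exponential_stability hQ hR hx₀ γ⟩⟩
  obtain ⟨K, hK⟩ := LQR.exists_isOptimal hAB hQ' hR hx₀
  exact ⟨K, hK, fun L hL => hK.eq hQ hR hx₀ hL⟩
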